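/- Let $[n]=\{1,\dots,n\}$. For $p\in(0,1)$ and $\mathcal A\subset 2^{[n]}$ put $\mu_p(\mathcal A)=\sum_{A\in\mathcal A}p^{|A|}(1-p)^{n-|A|}$, and for integers $t,r\ge 0$ let $\mathcal F^t_r=\{F\subset[n]:|F\cap[t+2r]|\ge t+r\}$. A family $\mathcal A$ is *shifted* if $A\in\mathcal A$ and $\{i,j\}\cap A=\{j\}$ with $i<j$ imply $(A\setminus\{j\})\cup\{i\}\in\mathcal A$; it is *inclusion maximal* if $A\in\mathcal A$ and $A\subset A'\subset[n]$ imply $A'\in\mathcal A$. Families $\mathcal A,\mathcal B\subset 2^{[n]}$ are *$t$-nice* if both are shifted and inclusion maximal and $|A\cap B|\ge t$ for all $A\in\mathcal A$, $B\in\mathcal B$. Let $R_{\rm ex}=\{(0,0),(1,1),(1,0)\}$ if $r=0$ and $R_{\rm ex}=\{(r-1,r-1),(r,r),(r+1,r+1),(r,r-1),(r+1,r)\}$ if $r\ge1$. For $(s,s')\in R_{\rm ex}$ put $u=t-(s-s')$, $v=t+(s-s')$ and $$X=p^{t-u}\mu_p(\mathcal A)+p^{t-v}\mu_p(\mathcal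 B),\qquad X_{\mathcal F}=p^{t-u}\mu_p(\mathcal F^u_s)+p^{t-v}\mu_p(\mathcal F^v_{s'}),$$ $$X_\Delta=p^{t-u}\mu_p(\mathcal A\triangle\mathcal F^u_s)+p^{t-v}\mu_p(\mathcal B\triangle\mathcal F^v_{s'}),\qquad X_*=p^{t-u}\mu_p(\mathcal A\setminus\mathcal F^u_s)+p^{t-v}\mu_p(\mathcal B\setminus\mathcal F^v_{s'}).$$ **Theorem.** For every integer $r\ge0$ and all reals $\epsilon,\epsilon_1\in(0,1/2)$ and $\delta_1\in(0,1/(r+2))$ there is a positive integer $t_0$, depending only on $r,\epsilon_1,\delta_1$ if $r\ge1$ and only on $\epsilon,\epsilon_1,\delta_1$ if $r=0$, such that the following holds for all integers $t\ge t_0$ and $n\ge t+2r$. Let $$\frac r{t+2r-1}\le p\le\frac{r+1}{t+2r+1}\ \text{ if } r\ge1,\qquad \frac\epsilon t\le p\le\frac1{t+1}\ \text{ if } r=0,$$ and let $\mathcal A,\mathcal B\subset2^{[n]}$ be $t$-nice families with $\mu_p(\mathcal A)\mu_p(\mathcal B)\ge(1-\delta_1)\mu_p(\mathcal F^t_r)^2$.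 Then, up to switching $\mathcal A$ and $\mathcal B$, there exists $(s,s')\in R_{\rm ex}$ such that (a) $X\le X_{\mathcal F}$, with equality if and only if $\mathcal A=\mathcal F^u_s$ and $\mathcal B=\mathcal F^v_{s'}$; (b) $X_*\le\epsilon_1X_\Delta$; (c) $\mu_p(\mathcal A)\mu_p(\mathcal B)\le\mu_p(\mathcal F^u_s)\mu_p(\mathcal F^v_{s'})$, with equality if and only if $\mathcal A=\mathcal F^u_s$ and $\mathcal B=\mathcal F^v_{s'}$. Moreover, if $\epsilon_1<\dfrac{\sqrt{1-\delta_1}}{1+\sqrt{1-\delta_1}}$ (in particular whenever $\epsilon_1\le 2/5$), then this pair is unique: no other element of $R_{\rm ex}$ satisfies (a), (b) and (c), for either order of the two families. -/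

import Mathlib

open Finset

namespace CrossIntersecting

noncomputable section

/-- The product measure `μ_p(𝒜) = ∑_{A ∈ 𝒜} p^|A| (1 - p)^(n - |A|)` of a family of subsets of an
`n`-element ground set. The ground set `[n]` is modelled by `Fin n`, so that the element `i + 1` of
`[n]` is `i : Fin n`. -/
def mu {n : ℕ} (p : ℝ) (𝒜 : Finset (Finset (Fin n))) : ℝ :=
  ∑ A ∈ 𝒜, p ^ A.card * (1 - p) ^ (n - A.card)

/-- The family `ℱ^t_r = {F ⊆ [n] : |F ∩ [t + 2r]| ≥ t + r}`. -/
def family (n t r : ℕ) : Finset (Finset (Fin n)) :=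
  {F : Finset (Fin n) | t + r ≤ (F.filter (fun i : Fin n => (i : ℕ) < t + 2 * r)).card}

/-- `|A ∩ B| ≥ t` for all `A ∈ 𝒜` and `B ∈ ℬ`. -/
def IsCrossIntersecting {n : ℕ} (t : ℕ) (𝒜 ℬ : Finset (Finset (Fin n))) : Prop :=
  ∀ A ∈ 𝒜, ∀ B ∈ ℬ, t ≤ (A ∩ B).card

/-- `𝒜` is shifted: if `A ∈ 𝒜`, `i < j` and `{i, j} ∩ A = {j}`, then `(A \ {j}) ∪ {i} ∈ 𝒜`. -/
def IsShifted {n : ℕ} (𝒜 : Finset (Finset (Fin n))) : Prop :=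
  ∀ A ∈ 𝒜, ∀ i j : Fin n, i < j → {i, j} ∩ A = {j} → (A \ {j}) ∪ {i} ∈ 𝒜

/-- `𝒜` is inclusion maximal: supersets of members are members. -/
def IsInclusionMaximal {n : ℕ} (𝒜 : Finset (Finset (Fin n))) : Prop :=
  ∀ A A' : Finset (Fin n), A ⊆ A' → A ∈ 𝒜 → A' ∈ 𝒜

/-- `𝒜` and `ℬ` are `t`-nice: shifted, inclusion maximal and cross `t`-intersecting. -/
structure IsNice {n : ℕ} (t : ℕ) (𝒜 ℬ : Finset (Finset (Fin n))) : Prop where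
  shifted_left : IsShifted 𝒜
  shifted_right : IsShifted ℬ
  maximal_left : IsInclusionMaximal 𝒜
  maximal_right : IsInclusionMaximal ℬ
  cross : IsCrossIntersecting t 𝒜 ℬ

/-- The set `R_ex` of the pairs `(s, s')` of subscripts of the extremal families. -/
def Rex (r : ℕ) : Set (ℕ × ℕ) :=
  if r = 0 then {(0, 0), (1, 1), (1, 0)}
  else {(r - 1, r - 1), (r, r), (r + 1, r + 1), (r, r - 1), (r + 1, r)}

/-- The normalised sum `p^(t-u) μ_p(𝒜) + p^(t-v) μ_p(ℬ)`, with integer exponents. -/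
def normSum {n : ℕ} (p : ℝ) (t u v : ℕ) (𝒜 ℬ : Finset (Finset (Fin n))) : ℝ :=
  p ^ ((t : ℤ) - (u : ℤ)) * mu p 𝒜 + p ^ ((t : ℤ) - (v : ℤ)) * mu p ℬ

/-- The three conclusions, for the ordered pair `(𝒜, ℬ)`, the pair of families
`(ℱ^u_s, ℱ^v_{s'})` and the constant `ε₁`. -/
structure Conclusions {n : ℕ} (p ε₁ : ℝ) (t u v s s' : ℕ)
    (𝒜 ℬ : Finset (Finset (Fin n))) : Prop where
  /-- `X ≤ X_ℱ` -/
  sum_le : normSum p t u v 𝒜 ℬ ≤ normSum p t u v (family n u s) (family n v s')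
  /-- equality in `X ≤ X_ℱ` -/
  sum_eq_iff : normSum p t u v 𝒜 ℬ = normSum p t u v (family n u s) (family n v s') ↔
    𝒜 = family n u s ∧ ℬ = family n v s'
  /-- `X_* ≤ ε₁ X_Δ` -/
  star_le : normSum p t u v (𝒜 \ family n u s) (ℬ \ family n v s') ≤
    ε₁ * normSum p t u v (symmDiff 𝒜 (family n u s)) (symmDiff ℬ (family n v s'))
  /-- the bound on the product of the measures -/
  prod_le : mu p 𝒜 * mu p ℬ ≤ mu p (family n u s) * mu p (family n v s')
  /-- equality in the bound on the product -/
  prod_eq_iff : mu p 𝒜 * mu p ℬ = mu p (family n u s) * mu p (family n v s') ↔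
    𝒜 = family n u s ∧ ℬ = family n v s'

/-- Up to switching `𝒜` and `ℬ`, the conclusions hold for the pair `σ = (s, s')`, with
`u = t - (s - s')` and `v = t + (s - s')`. It is used for `σ ∈ R_ex` only, where
`0 ≤ s - s' ≤ 1`, and for `t ≥ 1`, so that no subtraction is truncated. -/
def HoldsUpToSwitch {n : ℕ} (p ε₁ : ℝ) (t : ℕ) (σ : ℕ × ℕ)
    (𝒜 ℬ : Finset (Finset (Fin n))) : Prop :=
  Conclusions p ε₁ t (t - (σ.1 - σ.2)) (t + (σ.1 - σ.2)) σ.1 σ.2 𝒜 ℬ ∨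
  Conclusions p ε₁ t (t - (σ.1 - σ.2)) (t + (σ.1 - σ.2)) σ.1 σ.2 ℬ 𝒜

/-- The stability assertion for given `r`, `ε₁`, `δ₁`, `n`, `t`, `p`: every `t`-nice pair whose
product of measures is at least `(1 - δ₁) μ_p(ℱ^t_r)²` satisfies, up to switching, the conclusions
for some pair in `R_ex`; and this pair is the only one in `R_ex`, for either order of the two
families, as soon as `ε₁` is below the stated threshold. -/
def Stability (r : ℕ) (ε₁ δ₁ : ℝ) (n t : ℕ) (p : ℝ) : Prop :=
  ∀ 𝒜 ℬ : Finset (Finset (Fin n)), IsNice t 𝒜 ℬ →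
    (1 - δ₁) * mu p (family n t r) ^ 2 ≤ mu p 𝒜 * mu p ℬ →
    ∃ σ ∈ Rex r, HoldsUpToSwitch p ε₁ t σ 𝒜 ℬ ∧
      (ε₁ < √(1 - δ₁) / (1 + √(1 - δ₁)) →
        ∀ τ ∈ Rex r, HoldsUpToSwitch p ε₁ t τ 𝒜 ℬ → τ = σ)

end

end CrossIntersecting

namespace CrossIntersecting

/-! Read a set as a walk that steps up at its elements and down elsewhere, so that its height after
`i` steps is `2 * cnt A i - i`. Shifting turns the cross-intersection condition into a statement
about heights: for `A ∈ 𝒜` and `B ∈ ℬ` there is a time at which the two heights add up to at least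
`2t` (`IsNice.exists_le_cnt_add_cnt`).

Let `u` and `v` be the largest heights that all walks of `𝒜`, respectively `ℬ`, reach; then `u + v ≥
2t`. With `α = p / (1 - p)`, a random walk reaches height `u` with probability at most `α ^ u`, and
does so at two times with probability at most `2 α ^ (u + 1)`. Since `t p` is bounded above and
below, the hypothesis makes the product of the measures at least a constant times `p ^ (2t)`. For
small `p` this forces `u + v = 2t` and makes the walks with two hits negligible. Two walks, one from
each family, that hit their heights only once must hit them simultaneously, so all of these share
one hitting time `u + 2s = v + 2s'`: up to a relative error of order `p`, the families lie inside
`ℱ^u_s` and `ℱ^v_{s'}` (`IsNice.exists_families`).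

After scaling, the measures of these two families are `p ^ t` times `binom(t+s+s', s) p^s` and
`binom(t+s+s', s') p^s'`, up to `O(p)`. Outside `R_ex`, in either order, the product of these main
terms is at most `(r+1)/(r+2)` times the one for `(r, r)`, up to `O(p)`
(`Regime.exists_prodCoeff_le`); as `δ₁ < 1/(r+2)`, the pair lies in `R_ex`.

For the exact bounds, a member of `𝒜` outside `ℱ^u_s` keeps many sets of `ℱ^v_{s'}` out of `ℬ`
(`IsNice.exists_excluded`). Hence the excess of each family is at most a small multiple `η` of the
deficit of the other (`eventually_excess_le`), and (a), (b), (c) follow by algebra. For uniqueness,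
(b) alone suffices: a different exponent `u` changes the scale by a factor `p`, and a different
subscript with the same `u` gives families almost disjoint from `𝒜` and `ℬ`, which contradicts (b)
below the threshold for `ε₁`. -/

/-- The number of elements of `A` among the first `i` elements of the ground set. -/
def cnt {n : ℕ} (A : Finset (Fin n)) (i : ℕ) : ℕ :=
  (A.filter (fun j : Fin n => (j : ℕ) < i)).card

theorem mem_family {n t r : ℕ} {F : Finset (Fin n)} :
    F ∈ family n t r ↔ t + r ≤ cnt F (t + 2 * r) := by
  simp [family, cnt]

/-! ### Counting functions of sets -/

section Count

variable {n : ℕ} (A : Finset (Fin n))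

theorem cnt_zero : cnt A 0 = 0 := by simp [cnt]

theorem cnt_mono {i j : ℕ} (h : i ≤ j) : cnt A i ≤ cnt A j := by
  apply card_le_card
  intro x hx
  simp only [mem_filter] at hx ⊢
  exact ⟨hx.1, by omega⟩

theorem cnt_succ_le (i : ℕ) : cnt A (i + 1) ≤ cnt A i + 1 := by
  have h : A.filter (fun j : Fin n => (j : ℕ) < i + 1) ⊆
      A.filter (fun j : Fin n => (j : ℕ) < i) ∪ univ.filter (fun j : Fin n => (j : ℕ) = i) := by
    intro x hx
    simp only [mem_filter, mem_union, mem_univ, true_and] at hx ⊢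
    rcases Nat.lt_succ_iff_lt_or_eq.1 hx.2 with h | h
    · exact Or.inl ⟨hx.1, h⟩
    · exact Or.inr h
  refine (card_le_card h).trans ((card_union_le _ _).trans ?_)
  refine Nat.add_le_add_left (card_le_one.2 ?_) _
  intro a ha b hb
  simp only [mem_filter, mem_univ, true_and] at ha hb
  exact Fin.ext (ha.trans hb.symm)

theorem cnt_add_le (i k : ℕ) : cnt A (i + k) ≤ cnt A i + k := by
  induction k with
  | zero => simp
  | succ k ih => exact (cnt_succ_le A (i + k)).trans (by omega)

theorem cnt_le_add_sub {i j : ℕ} (h : i ≤ j) : cnt A j ≤ cnt A i + (j - i) := by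
  obtain ⟨k, rfl⟩ := Nat.exists_eq_add_of_le h
  simpa using cnt_add_le A i k

theorem cnt_le (i : ℕ) : cnt A i ≤ i := by
  simpa [cnt_zero] using cnt_add_le A 0 i

end Count

/-! ### Shifting and the height inequality -/

section Shift

variable {n t : ℕ} {𝒜 ℬ : Finset (Finset (Fin n))}

theorem cnt_add_cnt {A B : Finset (Fin n)} (i : ℕ) :
    cnt A i + cnt B i = cnt (A ∪ B) i + cnt (A ∩ B) i := by
  simp only [cnt, filter_union, filter_inter_distrib]
  exact (card_union_add_card_inter _ _).symm

theorem exists_cnt_eq_of_le_card {C : Finset (Fin n)} (ht : 1 ≤ t) (h : t ≤ C.card) :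
    ∃ j ∈ C, cnt C (j + 1) = t := by
  have hn : cnt C n = C.card := by
    unfold cnt
    congr 1
    exact filter_true_of_mem fun x _ => x.2
  have hex : ∃ i, t ≤ cnt C i := ⟨n, by omega⟩
  classical
  have h1 := Nat.find_spec hex
  have h0 : Nat.find hex ≠ 0 := by
    intro h0
    rw [h0, cnt_zero] at h1
    omega
  obtain ⟨k, hk⟩ := Nat.exists_eq_succ_of_ne_zero h0
  have h2 : cnt C k < t := not_le.1 (Nat.find_min hex (by omega))
  rw [hk, Nat.succ_eq_add_one] at h1
  have h3 := cnt_succ_le C k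
  have h4 : ¬ C.filter (fun j : Fin n => (j : ℕ) < k + 1) ⊆
      C.filter (fun j : Fin n => (j : ℕ) < k) := by
    intro hs
    have := card_le_card hs
    unfold cnt at *
    omega
  obtain ⟨x, hx, hx'⟩ := not_subset.1 h4
  simp only [mem_filter, not_and, not_lt] at hx hx'
  have hxk : (x : ℕ) = k := le_antisymm (by omega) (hx' hx.1)
  exact ⟨x, hx.1, by rw [hxk]; omega⟩

/-- In a nice pair, every two members have an initial segment in which they have many elements. -/
theorem IsNice.exists_le_cnt_add_cnt (h : IsNice t 𝒜 ℬ) {A B : Finset (Fin n)}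
    (hA : A ∈ 𝒜) (hB : B ∈ ℬ) : ∃ i ≤ n, i + t ≤ cnt A i + cnt B i := by
  rcases Nat.eq_zero_or_pos t with rfl | ht
  · exact ⟨0, by simp⟩
  induction hk : (A ∩ B).card using Nat.strong_induction_on generalizing A with
  | _ k ih =>
  by_contra! hcon
  -- With `j` the `t`-th common element, failure of the bound at `j + 1` leaves some `i < j` outside
  -- `A ∪ B`. Replacing `j` by `i` in `A` stays in `𝒜` and shrinks the intersection, so the
  -- induction hypothesis applies.
  obtain ⟨j, hj, hjt⟩ := exists_cnt_eq_of_le_card ht (h.cross A hA B hB)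
  rw [mem_inter] at hj
  have h1 := hcon (j + 1) j.2
  rw [cnt_add_cnt, hjt] at h1
  obtain ⟨i, hij, hi⟩ : ∃ i : Fin n, (i : ℕ) < j + 1 ∧ i ∉ A ∪ B := by
    by_contra! hall
    have : (A ∪ B).filter (fun x : Fin n => (x : ℕ) < j + 1) = Finset.Iic j := by
      ext x
      simp only [mem_filter, Finset.mem_Iic]
      constructor
      · rintro ⟨-, hx⟩
        exact Fin.le_def.2 (by omega)
      · intro hx
        have : (x : ℕ) < j + 1 := by
          have := Fin.le_def.1 hx
          omega
        exact ⟨hall x this, this⟩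
    rw [cnt, this, Fin.card_Iic] at h1
    omega
  simp only [mem_union, not_or] at hi
  have hne : i ≠ j := fun e => hi.1 (e ▸ hj.1)
  have hlt : i < j := lt_of_le_of_ne (Fin.le_def.2 (by omega)) hne
  have hA' : (A \ {j}) ∪ {i} ∈ 𝒜 := by
    apply h.shifted_left A hA i j hlt
    ext x
    simp only [mem_inter, mem_insert, mem_singleton]
    constructor
    · rintro ⟨rfl | rfl, hx⟩
      · exact absurd hx hi.1
      · rfl
    · rintro rfl
      exact ⟨Or.inr rfl, hj.1⟩
  set A' := (A \ {j}) ∪ {i} with hA'def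
  have hinter : A' ∩ B = (A ∩ B).erase j := by
    ext x
    simp only [hA'def, mem_inter, mem_union, mem_sdiff, mem_singleton, mem_erase]
    constructor
    · rintro ⟨⟨h1, h2⟩ | rfl, h3⟩
      · exact ⟨h2, h1, h3⟩
      · exact absurd h3 hi.2
    · rintro ⟨h1, h2, h3⟩
      exact ⟨Or.inl ⟨h2, h1⟩, h3⟩
  have hjAB : j ∈ A ∩ B := mem_inter.2 hj
  have hcard : (A' ∩ B).card < k := by
    rw [hinter, card_erase_of_mem hjAB]
    have := card_pos.2 ⟨j, hjAB⟩
    omega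
  obtain ⟨l, hl, hl'⟩ := ih _ hcard hA' rfl
  have hl2 := hcon l hl
  -- Beyond `j` the shift does not change the count of `A`. Up to `j`, fewer than `t` elements are
  -- common to `A'` and `B`, and the union has at most `l` elements, so the two counts sum to less
  -- than `l + t`.
  by_cases hlj : (j : ℕ) < l
  · have : cnt A' l = cnt A l := by
      have e : A'.filter (fun x : Fin n => (x : ℕ) < l) =
          insert i ((A.filter (fun x : Fin n => (x : ℕ) < l)).erase j) := by
        ext x
        simp only [hA'def, mem_filter, mem_union, mem_sdiff, mem_singleton, mem_insert, mem_erase]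
        constructor
        · rintro ⟨⟨h1, h2⟩ | rfl, h3⟩
          · exact Or.inr ⟨h2, h1, h3⟩
          · exact Or.inl rfl
        · rintro (rfl | ⟨h1, h2, h3⟩)
          · exact ⟨Or.inr rfl, lt_trans (Fin.lt_def.1 hlt) hlj⟩
          · exact ⟨Or.inl ⟨h2, h1⟩, h3⟩
      have hjm : j ∈ A.filter (fun x : Fin n => (x : ℕ) < l) := mem_filter.2 ⟨hj.1, hlj⟩
      rw [cnt, e, card_insert_of_notMem, card_erase_of_mem hjm, cnt]
      · have := card_pos.2 ⟨j, hjm⟩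
        omega
      · simp [hi.1]
    omega
  · have h5 : cnt (A' ∩ B) l < t := by
      have e : cnt (A' ∩ B) l ≤ ((A ∩ B).filter (fun x : Fin n => (x : ℕ) < j + 1)).card - 1 := by
        rw [← card_erase_of_mem (a := j) (by simp [hjAB])]
        apply card_le_card
        intro x hx
        rw [hinter] at hx
        simp only [mem_filter, mem_erase] at hx ⊢
        exact ⟨hx.1.1, hx.1.2, by omega⟩
      unfold cnt at *
      omega
    have h6 := cnt_add_cnt (A := A') (B := B) l
    have h7 := cnt_le (A' ∪ B) l
    omega

end Shift

/-! ### The product measure -/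

section Measure

variable {n : ℕ} {p : ℝ}

theorem mu_nonneg (hp : 0 ≤ p) (hp' : p ≤ 1) (𝒜 : Finset (Finset (Fin n))) : 0 ≤ mu p 𝒜 :=
  sum_nonneg fun _ _ => mul_nonneg (pow_nonneg hp _) (pow_nonneg (sub_nonneg.2 hp') _)

theorem mu_mono (hp : 0 ≤ p) (hp' : p ≤ 1) {𝒜 ℬ : Finset (Finset (Fin n))} (h : 𝒜 ⊆ ℬ) :
    mu p 𝒜 ≤ mu p ℬ :=
  sum_le_sum_of_subset_of_nonneg h fun _ _ _ =>
    mul_nonneg (pow_nonneg hp _) (pow_nonneg (sub_nonneg.2 hp') _)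

theorem mu_eq_zero_iff (hp : 0 < p) (hp' : p < 1) {𝒜 : Finset (Finset (Fin n))} :
    mu p 𝒜 = 0 ↔ 𝒜 = ∅ := by
  constructor
  · intro h
    by_contra hne
    have : 0 < mu p 𝒜 := sum_pos (fun _ _ => mul_pos (pow_pos hp _) (pow_pos (sub_pos.2 hp') _))
      (nonempty_iff_ne_empty.2 hne)
    exact this.ne' h
  · rintro rfl
    simp [mu]

theorem mu_inter_add_mu_sdiff (𝒜 ℬ : Finset (Finset (Fin n))) :
    mu p (𝒜 ∩ ℬ) + mu p (𝒜 \ ℬ) = mu p 𝒜 := by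
  rw [mu, mu, mu, ← sum_union (disjoint_sdiff_inter 𝒜 ℬ).symm, union_comm, sdiff_union_inter]

theorem mu_union_le (hp : 0 ≤ p) (hp' : p ≤ 1) (𝒜 ℬ : Finset (Finset (Fin n))) :
    mu p (𝒜 ∪ ℬ) ≤ mu p 𝒜 + mu p ℬ := by
  have h := sum_union_inter (s₁ := 𝒜) (s₂ := ℬ)
    (f := fun A : Finset (Fin n) => p ^ A.card * (1 - p) ^ (n - A.card))
  have h2 := mu_nonneg hp hp' (𝒜 ∩ ℬ)
  unfold mu at *
  linarith

theorem mu_symmDiff (𝒜 ℬ : Finset (Finset (Fin n))) :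
    mu p (symmDiff 𝒜 ℬ) = mu p (𝒜 \ ℬ) + mu p (ℬ \ 𝒜) := by
  rw [symmDiff_def, sup_eq_union]
  exact sum_union disjoint_sdiff_sdiff

end Measure

/-! ### Random walks and conditioning on the first step -/

section Walk

open Classical in
/-- The probability that the counting function of a `p`-random subset of an `n`-element set has the
property `R`. -/
noncomputable def walkProb (p : ℝ) (n : ℕ) (R : (ℕ → ℕ) → Prop) : ℝ :=
  mu p (univ.filter fun A : Finset (Fin n) => R (cnt A))

/-- The counting function that starts with a step of height `b` and goes on with `c`. -/
def push (b : ℕ) (c : ℕ → ℕ) : ℕ → ℕ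
  | 0 => 0
  | i + 1 => c i + b

theorem cnt_map_succ {n : ℕ} (A : Finset (Fin n)) :
    cnt (A.map (Fin.succEmb n)) = push 0 (cnt A) := by
  funext i
  cases i with
  | zero => simp [cnt_zero, push]
  | succ i =>
    simp only [push, cnt, filter_map, card_map, add_zero]
    congr 1
    ext x
    simp

theorem cnt_insert_zero_map_succ {n : ℕ} (A : Finset (Fin n)) :
    cnt (insert 0 (A.map (Fin.succEmb n))) = push 1 (cnt A) := by
  funext i
  cases i with
  | zero => simp [cnt_zero, push]
  | succ i =>
    have h := congrFun (cnt_map_succ A) (i + 1)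
    simp only [push, add_zero] at h ⊢
    rw [← h, cnt, filter_insert, if_pos (by simp), card_insert_of_notMem]
    · rfl
    · simp [Fin.succ_ne_zero]

theorem sum_finset_fin_succ {n : ℕ} (f : Finset (Fin (n + 1)) → ℝ) :
    ∑ A, f A = ∑ A : Finset (Fin n), f (insert 0 (A.map (Fin.succEmb n))) +
      ∑ A : Finset (Fin n), f (A.map (Fin.succEmb n)) := by
  rw [← sum_filter_add_sum_filter_not univ (fun A : Finset (Fin (n + 1)) => (0 : Fin (n + 1)) ∈ A)]
  congr 1
  · symm
    refine sum_nbij' (fun A => insert 0 (A.map (Fin.succEmb n)))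
      (fun A => univ.filter fun i : Fin n => i.succ ∈ A) ?_ ?_ ?_ ?_ ?_
    · simp
    · simp
    · intro A _
      ext x
      simp [Fin.succ_ne_zero]
    · intro A hA
      simp only [mem_filter, mem_univ, true_and] at hA
      ext x
      refine Fin.cases ?_ (fun i => ?_) x
      · simp [hA]
      · simp [Fin.succ_ne_zero]
    · simp
  · symm
    refine sum_nbij' (fun A => A.map (Fin.succEmb n))
      (fun A => univ.filter fun i : Fin n => i.succ ∈ A) ?_ ?_ ?_ ?_ ?_
    · simp [Fin.succ_ne_zero]
    · simp
    · intro A _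
      ext x
      simp
    · intro A hA
      simp only [mem_filter, mem_univ, true_and] at hA
      ext x
      refine Fin.cases ?_ (fun i => ?_) x
      · simp [hA, Fin.succ_ne_zero]
      · simp
    · simp

variable {p : ℝ}

/-- Conditioning on the first element; the estimates below are inductions on `n` through this
identity. -/
theorem walkProb_succ (n : ℕ) (R : (ℕ → ℕ) → Prop) :
    walkProb p (n + 1) R =
      p * walkProb p n (fun c => R (push 1 c)) + (1 - p) * walkProb p n (fun c => R (push 0 c)) := by
  classical
  simp only [walkProb, mu, sum_filter]
  rw [sum_finset_fin_succ, mul_sum, mul_sum]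
  congr 1
  · refine sum_congr rfl fun A _ => ?_
    rw [cnt_insert_zero_map_succ]
    split_ifs
    · rw [card_insert_of_notMem (by simp [Fin.succ_ne_zero]), card_map, pow_succ,
        Nat.add_sub_add_right]
      ring
    · simp
  · refine sum_congr rfl fun A _ => ?_
    rw [cnt_map_succ]
    split_ifs
    · have h : A.card ≤ n := by simpa using card_le_univ A
      rw [card_map, Nat.sub_add_comm h, pow_succ]
      ring
    · simp

theorem walkProb_zero (R : (ℕ → ℕ) → Prop) [Decidable (R fun _ => 0)] :
    walkProb p 0 R = if R fun _ => 0 then 1 else 0 := by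
  classical
  have h1 : (cnt (∅ : Finset (Fin 0))) = fun _ => 0 := by
    funext i
    simp [cnt]
  have h2 : (univ : Finset (Finset (Fin 0))) = {∅} := rfl
  rw [walkProb, mu, sum_filter, h2, sum_singleton, h1]
  simp

theorem walkProb_zero_of (R : (ℕ → ℕ) → Prop) (h : R fun _ => 0) : walkProb p 0 R = 1 := by
  classical
  rw [walkProb_zero, if_pos h]

theorem walkProb_zero_of_not (R : (ℕ → ℕ) → Prop) (h : ¬ R fun _ => 0) : walkProb p 0 R = 0 := by
  classical
  rw [walkProb_zero, if_neg h]

theorem walkProb_mono (hp : 0 ≤ p) (hp' : p ≤ 1) {n : ℕ} {R R' : (ℕ → ℕ) → Prop}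
    (h : ∀ c, R c → R' c) : walkProb p n R ≤ walkProb p n R' := by
  classical
  apply mu_mono hp hp'
  intro A
  simp only [mem_filter, mem_univ, true_and]
  exact h _

theorem walkProb_add_not (n : ℕ) (R : (ℕ → ℕ) → Prop) :
    walkProb p n R + walkProb p n (fun c => ¬ R c) = 1 := by
  induction n generalizing R with
  | zero =>
    by_cases h : R fun _ => 0
    · rw [walkProb_zero_of _ h, walkProb_zero_of_not _ (by simpa using h), add_zero]
    · rw [walkProb_zero_of_not _ h, walkProb_zero_of _ (by simpa using h), zero_add]
  | succ n ih =>
    rw [walkProb_succ, walkProb_succ]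
    have h1 := ih fun c => R (push 1 c)
    have h2 := ih fun c => R (push 0 c)
    linear_combination p * h1 + (1 - p) * h2

theorem walkProb_nonneg (hp : 0 ≤ p) (hp' : p ≤ 1) (n : ℕ) (R : (ℕ → ℕ) → Prop) :
    0 ≤ walkProb p n R := mu_nonneg hp hp' _

theorem walkProb_le_one (hp : 0 ≤ p) (hp' : p ≤ 1) (n : ℕ) (R : (ℕ → ℕ) → Prop) :
    walkProb p n R ≤ 1 := by
  have := walkProb_add_not (p := p) n R
  have := walkProb_nonneg hp hp' n fun c => ¬ R c
  linarith

theorem mu_le_walkProb (hp : 0 ≤ p) (hp' : p ≤ 1) {n : ℕ} {R : (ℕ → ℕ) → Prop}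
    {𝒜 : Finset (Finset (Fin n))} (h : ∀ A ∈ 𝒜, R (cnt A)) : mu p 𝒜 ≤ walkProb p n R := by
  classical
  apply mu_mono hp hp'
  intro A hA
  simpa using h A hA

theorem walkProb_le_mu (hp : 0 ≤ p) (hp' : p ≤ 1) {n : ℕ} {R : (ℕ → ℕ) → Prop}
    {𝒜 : Finset (Finset (Fin n))} (h : ∀ A, R (cnt A) → A ∈ 𝒜) : walkProb p n R ≤ mu p 𝒜 := by
  classical
  apply mu_mono hp hp'
  intro A hA
  exact h A (by simpa using hA)

end Walk

/-! ### Estimates for random walks -/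

section WalkEstimates

variable {p : ℝ}

/-- Unlike in `walkProb_mono`, the implication is needed only for genuine counting functions, so
facts such as `cnt A i ≤ i` may be used. -/
theorem walkProb_mono_cnt (hp : 0 ≤ p) (hp' : p ≤ 1) {n : ℕ} {R R' : (ℕ → ℕ) → Prop}
    (h : ∀ A : Finset (Fin n), R (cnt A) → R' (cnt A)) : walkProb p n R ≤ walkProb p n R' := by
  classical
  apply mu_mono hp hp'
  intro A
  simp only [mem_filter, mem_univ, true_and]
  exact h _

/-- The function `α ^ height` is harmonic for the walk: a step up leaves `u` to climb, a step down
leaves `u + 2`. -/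
theorem odds_pow_step (hp' : p < 1) (u : ℕ) :
    p * (p / (1 - p)) ^ u + (1 - p) * (p / (1 - p)) ^ (u + 2) = (p / (1 - p)) ^ (u + 1) := by
  have hq : 1 - p ≠ 0 := by linarith
  have h : p = (1 - p) * (p / (1 - p)) := by field_simp
  set α := p / (1 - p)
  rw [pow_succ, pow_add]
  linear_combination (α ^ u - α ^ u * α) * h

/-- A walk with up-probability `p` reaches height `u` with probability at most `(p / (1 - p)) ^ u`. -/
theorem walkProb_hit_le (hp : 0 < p) (hp' : p ≤ 1 / 2) (n u : ℕ) :
    walkProb p n (fun c => ∃ i, i + u ≤ 2 * c i) ≤ (p / (1 - p)) ^ u := by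
  have hα : 0 ≤ p / (1 - p) := div_nonneg hp.le (by linarith)
  induction n generalizing u with
  | zero =>
    cases u with
    | zero => simpa using walkProb_le_one hp.le (by linarith) 0 _
    | succ u =>
      rw [walkProb_zero_of_not]
      · positivity
      · simp
  | succ n ih =>
    cases u with
    | zero => simpa using walkProb_le_one hp.le (by linarith) (n + 1) _
    | succ u =>
      rw [walkProb_succ, ← odds_pow_step (by linarith)]
      refine add_le_add (mul_le_mul_of_nonneg_left ?_ hp.le)
        (mul_le_mul_of_nonneg_left ?_ (by linarith))
      · refine (walkProb_mono hp.le (by linarith) ?_).trans (ih u)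
        rintro c ⟨_ | i, hi⟩
        · simp [push] at hi
        · simp only [push] at hi
          exact ⟨i, by omega⟩
      · refine (walkProb_mono hp.le (by linarith) ?_).trans (ih (u + 2))
        rintro c ⟨_ | i, hi⟩
        · simp [push] at hi
        · simp only [push] at hi
          exact ⟨i, by omega⟩

/-- Harmonicity reduces to `u = 0`, where time `0` may serve as the first hit. A step up is bounded
trivially, and after a step down the walk must climb back by one, which gives `p + (1 - p) α = 2p ≤
2α`. -/
theorem walkProb_hit_twice_le (hp : 0 < p) (hp' : p ≤ 1 / 2) (n u : ℕ) :
    walkProb p n (fun c => ∃ i j, i < j ∧ i + u ≤ 2 * c i ∧ j + u ≤ 2 * c j) ≤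
      2 * (p / (1 - p)) ^ (u + 1) := by
  have hα : 0 ≤ p / (1 - p) := div_nonneg hp.le (by linarith)
  induction n generalizing u with
  | zero =>
    rw [walkProb_zero_of_not]
    · positivity
    · rintro ⟨i, j, h1, h2, h3⟩
      dsimp only at h2 h3
      omega
  | succ n ih =>
    cases u with
    | zero =>
      have h1 : walkProb p n (fun c => ∃ i j, i < j ∧ i + 0 ≤ 2 * push 1 c i ∧
          j + 0 ≤ 2 * push 1 c j) ≤ 1 := walkProb_le_one hp.le (by linarith) _ _
      have h0 : walkProb p n (fun c => ∃ i j, i < j ∧ i + 0 ≤ 2 * push 0 c i ∧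
          j + 0 ≤ 2 * push 0 c j) ≤ (p / (1 - p)) ^ 1 := by
        refine (walkProb_mono hp.le (by linarith) ?_).trans (walkProb_hit_le hp hp' n 1)
        rintro c ⟨i, _ | j, h1, h2, h3⟩
        · omega
        · simp only [push] at h3
          exact ⟨j, by omega⟩
      rw [walkProb_succ]
      have h : p = (1 - p) * (p / (1 - p)) := by
        have : 1 - p ≠ 0 := by linarith
        field_simp
      have hle : p ≤ p / (1 - p) := by
        rw [le_div_iff₀ (by linarith)]
        nlinarith
      have h2 := mul_le_mul_of_nonneg_left h1 hp.le
      have h3 := mul_le_mul_of_nonneg_left h0 (show 0 ≤ 1 - p by linarith)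
      rw [pow_one, ← h] at h3
      rw [zero_add, pow_one]
      linarith
    | succ u =>
      rw [walkProb_succ, ← odds_pow_step (by linarith), mul_add, mul_left_comm, mul_left_comm 2]
      refine add_le_add (mul_le_mul_of_nonneg_left ?_ hp.le)
        (mul_le_mul_of_nonneg_left ?_ (by linarith))
      · refine (walkProb_mono hp.le (by linarith) ?_).trans (ih u)
        rintro c ⟨_ | i, _ | j, h1, h2, h3⟩
        · omega
        · simp [push] at h2
        · omega
        · simp only [push] at h2 h3
          exact ⟨i, j, by omega, by omega, by omega⟩
      · refine (walkProb_mono hp.le (by linarith) ?_).trans (ih (u + 2))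
        rintro c ⟨_ | i, _ | j, h1, h2, h3⟩
        · omega
        · simp [push] at h2
        · omega
        · simp only [push] at h2 h3
          exact ⟨i, j, by omega, by omega, by omega⟩

/-- A union bound over the sets of `k` elements among the first `k + s`; in the induction it appears
as Pascal's rule. -/
theorem walkProb_few_misses_le (hp : 0 < p) (hp' : p ≤ 1) (n k s : ℕ) :
    walkProb p n (fun c => k ≤ c (k + s)) ≤ (k + s).choose s * p ^ k := by
  have h1 : ∀ (R : (ℕ → ℕ) → Prop) (n s : ℕ), walkProb p n R ≤ (0 + s).choose s * p ^ 0 := by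
    intro R n s
    simpa using walkProb_le_one hp.le hp' n R
  induction n generalizing k s with
  | zero =>
    cases k with
    | zero => exact h1 _ _ _
    | succ k =>
      rw [walkProb_zero_of_not]
      · positivity
      · simp
  | succ n ih =>
    cases k with
    | zero => exact h1 _ _ _
    | succ k =>
      rw [walkProb_succ]
      have hA : walkProb p n (fun c => k + 1 ≤ push 1 c (k + 1 + s)) ≤
          (k + s).choose s * p ^ k := by
        refine (walkProb_mono hp.le hp' ?_).trans (ih k s)
        intro c hc
        rw [show k + 1 + s = k + s + 1 by omega, push] at hc
        omega
      have hA' := mul_le_mul_of_nonneg_left hA hp.le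
      cases s with
      | zero =>
        have hB : walkProb p n (fun c => k + 1 ≤ push 0 c (k + 1 + 0)) ≤ 0 := by
          refine (walkProb_mono_cnt hp.le hp' (R' := fun _ => False) ?_).trans ?_
          · intro A hA
            simp only [push, add_zero] at hA
            have := cnt_le A k
            omega
          · simp [walkProb, mu]
        have hB' := mul_le_mul_of_nonneg_left hB (sub_nonneg.2 hp')
        simp only [Nat.choose_zero_right, Nat.cast_one, one_mul] at hA' ⊢
        rw [pow_succ]
        linarith
      | succ s =>
        have hB : walkProb p n (fun c => k + 1 ≤ push 0 c (k + 1 + (s + 1))) ≤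
            (k + 1 + s).choose s * p ^ (k + 1) := by
          refine (walkProb_mono hp.le hp' ?_).trans (ih (k + 1) s)
          intro c hc
          rw [show k + 1 + (s + 1) = k + 1 + s + 1 by omega, push] at hc
          omega
        have hB' := mul_le_mul_of_nonneg_left hB (sub_nonneg.2 hp')
        have hpas : (((k + 1 + (s + 1)).choose (s + 1) : ℕ) : ℝ) =
            (k + 1 + s).choose s + (k + (s + 1)).choose (s + 1) := by
          rw [show k + 1 + (s + 1) = (k + 1 + s) + 1 by omega, Nat.choose_succ_succ',
            show k + (s + 1) = k + 1 + s by omega]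
          push_cast
          ring
        have hnn : 0 ≤ p * (((k + 1 + s).choose s : ℕ) * p ^ (k + 1)) := by positivity
        rw [hpas]
        have e : p * (((k + (s + 1)).choose (s + 1) : ℕ) * p ^ k) =
            ((k + (s + 1)).choose (s + 1) : ℕ) * p ^ (k + 1) := by ring
        rw [e] at hA'
        linarith

theorem mu_family_le (hp : 0 < p) (hp' : p ≤ 1) (n u s : ℕ) :
    mu p (family n u s) ≤ (u + 2 * s).choose s * p ^ (u + s) := by
  have h := walkProb_few_misses_le hp hp' n (u + s) s
  rw [show u + s + s = u + 2 * s by omega] at h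
  exact (mu_le_walkProb hp.le hp' fun A hA => mem_family.1 hA).trans h

/-- Independence of the first `k + s` elements from the rest, with Pascal's rule supplying the
binomial coefficient. Iterating it builds walks from prescribed blocks. -/
theorem le_walkProb_misses (hp : 0 < p) (hp' : p ≤ 1) (k s l : ℕ) (R : (ℕ → ℕ) → Prop) :
    (k + s).choose s * p ^ k * (1 - p) ^ s * walkProb p l R ≤
      walkProb p (k + s + l) (fun c => c (k + s) = k ∧ R fun i => c (k + s + i) - k) := by
  have hq : 0 ≤ 1 - p := sub_nonneg.2 hp'
  induction hm : k + s generalizing k s with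
  | zero =>
    obtain rfl : k = 0 := by omega
    obtain rfl : s = 0 := by omega
    rw [zero_add]
    simp only [Nat.choose_self, Nat.cast_one, pow_zero, mul_one, one_mul, zero_add, Nat.sub_zero]
    exact walkProb_mono_cnt hp.le hp' fun A hA => ⟨cnt_zero A, hA⟩
  | succ m ih =>
    rw [show m + 1 + l = (m + l) + 1 by omega, walkProb_succ]
    have hup : ∀ k', k = k' + 1 → (m.choose s : ℝ) * p ^ k' * (1 - p) ^ s * walkProb p l R ≤
        walkProb p (m + l) (fun c => push 1 c (m + 1) = k ∧
          R fun i => push 1 c (m + 1 + i) - k) := by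
      intro k' hk'
      refine (ih k' s (by omega)).trans (walkProb_mono hp.le hp' ?_)
      rintro c ⟨h1, h2⟩
      refine ⟨by simp only [push]; omega, ?_⟩
      convert h2 using 2 with i
      rw [show m + 1 + i = (m + i) + 1 by omega, push]
      omega
    have hdown : ∀ s', s = s' + 1 → (m.choose s' : ℝ) * p ^ k * (1 - p) ^ s' * walkProb p l R ≤
        walkProb p (m + l) (fun c => push 0 c (m + 1) = k ∧
          R fun i => push 0 c (m + 1 + i) - k) := by
      intro s' hs'
      refine (ih k s' (by omega)).trans (walkProb_mono hp.le hp' ?_)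
      rintro c ⟨h1, h2⟩
      refine ⟨by simp only [push]; omega, ?_⟩
      convert h2 using 2 with i
      rw [show m + 1 + i = (m + i) + 1 by omega, push]
      omega
    have hn1 := mul_nonneg hp.le (walkProb_nonneg hp.le hp' (m + l)
      (fun c => push 1 c (m + 1) = k ∧ R fun i => push 1 c (m + 1 + i) - k))
    have hn0 := mul_nonneg hq (walkProb_nonneg hp.le hp' (m + l)
      (fun c => push 0 c (m + 1) = k ∧ R fun i => push 0 c (m + 1 + i) - k))
    rcases s with _ | s
    · obtain ⟨k, rfl⟩ : ∃ k', k = k' + 1 := ⟨k - 1, by omega⟩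
      have h := mul_le_mul_of_nonneg_left (hup k rfl) hp.le
      simp only [Nat.choose_zero_right, Nat.cast_one, pow_zero, pow_succ] at h ⊢
      linarith
    · have h0 := mul_le_mul_of_nonneg_left (hdown s rfl) hq
      rcases k with _ | k
      · obtain rfl : m = s := by omega
        simp only [Nat.choose_self, Nat.cast_one, pow_zero, pow_succ] at h0 ⊢
        linarith
      · have h1 := mul_le_mul_of_nonneg_left (hup k rfl) hp.le
        rw [Nat.choose_succ_succ']
        push_cast
        rw [pow_succ] at h0 h1 ⊢
        rw [pow_succ]
        linarith

theorem le_walkProb_tail (hp : 0 < p) (hp' : p ≤ 1 / 2) (n : ℕ) :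
    1 - p / (1 - p) ≤ walkProb p n (fun c => ∀ i, 2 * c i ≤ i) := by
  have h := walkProb_add_not (p := p) n fun c => ∃ i, i + 1 ≤ 2 * c i
  have h1 := walkProb_hit_le hp hp' n 1
  have h2 : walkProb p n (fun c => ¬ ∃ i, i + 1 ≤ 2 * c i) ≤
      walkProb p n (fun c => ∀ i, 2 * c i ≤ i) := by
    refine walkProb_mono hp.le (by linarith) fun c hc i => ?_
    push Not at hc
    have := hc i
    omega
  rw [pow_one] at h1
  linarith

/-- A lower bound for the probability to miss exactly `s` of the first `t` elements, to contain the
next `b` elements, to miss the next `K` elements, and never to have a positive balance afterwards. -/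
theorem le_walkProb_generic (hp : 0 < p) (hp' : p ≤ 1 / 2) {n t s b K : ℕ} (hs : s ≤ t)
    (hn : t + b + K ≤ n) :
    t.choose s * p ^ (t - s + b) * (1 - p) ^ (s + K) * (1 - p / (1 - p)) ≤
      walkProb p n (fun c => c t + s = t ∧ c (t + b) + s = t + b ∧ c (t + b + K) + s = t + b ∧
        ∀ i, 2 * c (t + b + K + i) + 2 * s ≤ 2 * (t + b) + i) := by
  obtain ⟨l, rfl⟩ := Nat.exists_eq_add_of_le hn
  have hp1 : p ≤ 1 := by linarith
  have h3 := le_walkProb_misses hp hp1 0 K l fun c => ∀ i, 2 * c i ≤ i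
  have h2 := le_walkProb_misses hp hp1 b 0 (0 + K + l)
    (R := fun c => c (0 + K) = 0 ∧ ∀ i, 2 * (c (0 + K + i) - 0) ≤ i)
  have h1 := le_walkProb_misses hp hp1 (t - s) s (b + 0 + (0 + K + l))
    (R := fun c => c (b + 0) = b ∧ c (b + 0 + (0 + K)) - b = 0 ∧
      ∀ i, 2 * (c (b + 0 + (0 + K + i)) - b - 0) ≤ i)
  have ht := le_walkProb_tail hp hp' l
  rw [show t - s + s = t by omega] at h1
  have hq : 0 ≤ 1 - p := by linarith
  simp only [zero_add, Nat.choose_self, Nat.cast_one, one_mul, pow_zero, Nat.choose_zero_right,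
    mul_one, add_zero, Nat.sub_zero] at h1 h2 h3
  calc (t.choose s : ℝ) * p ^ (t - s + b) * (1 - p) ^ (s + K) * (1 - p / (1 - p))
      = t.choose s * p ^ (t - s) * (1 - p) ^ s * (p ^ b * ((1 - p) ^ K * (1 - p / (1 - p)))) := by
        rw [pow_add, pow_add]; ring
    _ ≤ t.choose s * p ^ (t - s) * (1 - p) ^ s * walkProb p (b + (K + l)) (fun c => c b = b ∧
          c (b + K) - b = 0 ∧ ∀ i, 2 * (c (b + (K + i)) - b) ≤ i) := by
        refine mul_le_mul_of_nonneg_left ?_ (by positivity)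
        refine le_trans ?_ h2
        refine mul_le_mul_of_nonneg_left ?_ (by positivity)
        refine le_trans ?_ h3
        exact mul_le_mul_of_nonneg_left ht (by positivity)
    _ ≤ _ := by
        refine h1.trans ?_
        rw [show t + (b + (K + l)) = t + b + K + l by omega]
        refine walkProb_mono_cnt hp.le hp1 ?_
        rintro A ⟨e1, e2, e3, e4⟩
        have hm : Monotone (cnt A) := fun i j h => cnt_mono A h
        generalize cnt A = c at e1 e2 e3 e4 hm ⊢
        have m1 := hm (show t ≤ t + b by omega)
        have m2 := hm (show t + b ≤ t + (b + K) by omega)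
        rw [show t + b + K = t + (b + K) by omega]
        refine ⟨by omega, by omega, by omega, fun i => ?_⟩
        have m3 := e4 i
        have m4 := hm (show t + b ≤ t + (b + (K + i)) by omega)
        rw [show t + (b + K) + i = t + (b + (K + i)) by omega]
        omega

theorem le_mu_family (hp : 0 < p) (hp' : p ≤ 1) {n u s : ℕ} (hn : u + 2 * s ≤ n) :
    (u + 2 * s).choose s * p ^ (u + s) * (1 - p) ^ s ≤ mu p (family n u s) := by
  obtain ⟨l, rfl⟩ := Nat.exists_eq_add_of_le hn
  have h := le_walkProb_misses hp hp' (u + s) s l fun _ => True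
  have h1 : walkProb p l (fun _ => True) = 1 := by
    have := walkProb_add_not (p := p) l fun _ => True
    have h0 : walkProb p l (fun _ => ¬ True) = 0 := by simp [walkProb, mu]
    linarith
  rw [h1, mul_one, show u + s + s = u + 2 * s by omega] at h
  refine h.trans (walkProb_le_mu hp.le hp' ?_)
  rintro A ⟨hA, -⟩
  exact mem_family.2 hA.ge

/-- A common member reaches height `u` at the two distinct times `u + 2 * s` and `u + 2 * w`. -/
theorem mu_family_inter_family_le (hp : 0 < p) (hp' : p ≤ 1 / 2) (n u : ℕ) {s w : ℕ}
    (h : s ≠ w) : mu p (family n u s ∩ family n u w) ≤ 2 * (p / (1 - p)) ^ (u + 1) := by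
  refine (mu_le_walkProb hp.le (by linarith) ?_).trans (walkProb_hit_twice_le hp hp' n u)
  intro A hA
  rw [mem_inter, mem_family, mem_family] at hA
  rcases lt_or_gt_of_ne h with h | h
  · exact ⟨u + 2 * s, u + 2 * w, by omega, by omega, by omega⟩
  · exact ⟨u + 2 * w, u + 2 * s, by omega, by omega, by omega⟩

end WalkEstimates

/-! ### Approximation by extremal families, and excluded sets -/

section Structure

variable {p : ℝ} {n t : ℕ} {𝒜 ℬ : Finset (Finset (Fin n))}

theorem IsNice.symm (h : IsNice t 𝒜 ℬ) : IsNice t ℬ 𝒜 :=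
  ⟨h.shifted_right, h.shifted_left, h.maximal_right, h.maximal_left, fun B hB A hA => by
    rw [inter_comm]
    exact h.cross A hA B hB⟩

theorem exists_max_hit (h : 𝒜.Nonempty) : ∃ u, (∀ A ∈ 𝒜, ∃ i, i + u ≤ 2 * cnt A i) ∧
    ∃ A ∈ 𝒜, ∀ i, 2 * cnt A i ≤ i + u := by
  classical
  obtain ⟨A₀, hA₀⟩ := h
  have hb : ∀ (A : Finset (Fin n)) (i : ℕ), cnt A i ≤ n := fun A i =>
    (card_le_univ _).trans (by simp)
  let P : ℕ → Prop := fun u => ∀ A ∈ 𝒜, ∃ i, i + u ≤ 2 * cnt A i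
  have h0 : P 0 := fun A _ => ⟨0, by simp⟩
  refine ⟨Nat.findGreatest P (2 * n + 1), Nat.findGreatest_spec (Nat.zero_le _) h0, ?_⟩
  -- Height `2 * n + 1` is out of reach, so the search stops strictly below its bound and the next
  -- height fails.
  have hle : Nat.findGreatest P (2 * n + 1) < 2 * n + 1 := by
    rcases (Nat.findGreatest_le (P := P) (2 * n + 1)).lt_or_eq with h | h
    · exact h
    · obtain ⟨i, hi⟩ := (h ▸ Nat.findGreatest_spec (Nat.zero_le _) h0 : P (2 * n + 1)) A₀ hA₀
      have := hb A₀ i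
      omega
  have hnot : ¬ P (Nat.findGreatest P (2 * n + 1) + 1) :=
    Nat.findGreatest_is_greatest (Nat.lt_succ_self _) hle
  simp only [P, not_forall, not_exists, not_le] at hnot
  obtain ⟨A, hA, h⟩ := hnot
  exact ⟨A, hA, fun i => Nat.lt_succ_iff.1 (h i)⟩

/-- The members of a family that reach height `u` at a single time only. -/
noncomputable def singleHit (u : ℕ) (𝒜 : Finset (Finset (Fin n))) : Finset (Finset (Fin n)) := by
  classical
  exact 𝒜.filter fun A => ¬ ∃ i j, i < j ∧ i + u ≤ 2 * cnt A i ∧ j + u ≤ 2 * cnt A j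

theorem singleHit_subset (u : ℕ) : singleHit u 𝒜 ⊆ 𝒜 := by
  classical
  exact filter_subset _ _

theorem eq_of_mem_singleHit {u : ℕ} {A : Finset (Fin n)} (hA : A ∈ singleHit u 𝒜) {i j : ℕ}
    (hi : i + u ≤ 2 * cnt A i) (hj : j + u ≤ 2 * cnt A j) : i = j := by
  classical
  have h : ¬ ∃ i j, i < j ∧ i + u ≤ 2 * cnt A i ∧ j + u ≤ 2 * cnt A j := (mem_filter.1 hA).2
  rcases lt_trichotomy i j with hij | hij | hij
  · exact absurd ⟨i, j, hij, hi, hj⟩ h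
  · exact hij
  · exact absurd ⟨j, i, hij, hj, hi⟩ h

/-- A walk strictly above `u` was at height at least `u` one step earlier as well, which would be a
second hit. -/
theorem le_of_mem_singleHit {u : ℕ} {A : Finset (Fin n)} (hA : A ∈ singleHit u 𝒜) (i : ℕ) :
    2 * cnt A i ≤ i + u := by
  by_contra! h
  rcases i with _ | i
  · rw [cnt_zero] at h
    omega
  · have h1 := cnt_succ_le A i
    have := eq_of_mem_singleHit hA (i := i) (j := i + 1) (by omega) (by omega)
    omega

theorem mu_sdiff_singleHit_le (hp : 0 < p) (hp' : p ≤ 1 / 2) (u : ℕ) :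
    mu p (𝒜 \ singleHit u 𝒜) ≤ 2 * (p / (1 - p)) ^ (u + 1) := by
  classical
  refine (mu_le_walkProb hp.le (by linarith) ?_).trans (walkProb_hit_twice_le hp hp' n u)
  intro A hA
  rw [mem_sdiff] at hA
  by_contra h
  exact hA.2 (mem_filter.2 ⟨hA.1, h⟩)

/-- Largeness of the product rules out `u + v > 2t` and guarantees single-hit members on both sides.
For two of these the height inequality must be an equality, attained at the hitting time of each;
comparison with one fixed member on either side makes this time `m` common to all. Then `s` and `s'`
are the numbers of misses before `m`. -/
theorem IsNice.exists_families (h : IsNice t 𝒜 ℬ) (hp : 0 < p) (hp' : p ≤ 1 / 2)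
    (hμ : 2 * (p / (1 - p)) ^ (2 * t + 1) < mu p 𝒜 * mu p ℬ) :
    ∃ u v s s' : ℕ, u + v = 2 * t ∧ u + 2 * s = v + 2 * s' ∧ u + 2 * s ≤ n ∧
      mu p 𝒜 ≤ (p / (1 - p)) ^ u ∧ mu p ℬ ≤ (p / (1 - p)) ^ v ∧
      mu p (𝒜 \ family n u s) ≤ 2 * (p / (1 - p)) ^ (u + 1) ∧
      mu p (ℬ \ family n v s') ≤ 2 * (p / (1 - p)) ^ (v + 1) := by
  have hα : 0 < p / (1 - p) := div_pos hp (by linarith)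
  have hα1 : p / (1 - p) ≤ 1 := by
    rw [div_le_one (by linarith)]
    linarith
  have hp1 : p ≤ 1 := by linarith
  set α := p / (1 - p) with hαdef
  have hA0 := mu_nonneg hp.le hp1 𝒜
  have hB0 := mu_nonneg hp.le hp1 ℬ
  have hpow := pow_pos hα (2 * t + 1)
  have hAne : 𝒜.Nonempty := by
    rw [nonempty_iff_ne_empty]
    rintro rfl
    simp [mu] at hμ
    linarith
  have hBne : ℬ.Nonempty := by
    rw [nonempty_iff_ne_empty]
    rintro rfl
    simp [mu] at hμ
    linarith
  obtain ⟨u, hu, A₀, hA₀, huA⟩ := exists_max_hit hAne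
  obtain ⟨v, hv, B₀, hB₀, hvB⟩ := exists_max_hit hBne
  have hAu : mu p 𝒜 ≤ α ^ u := (mu_le_walkProb hp.le hp1 hu).trans (walkProb_hit_le hp hp' n u)
  have hBv : mu p ℬ ≤ α ^ v := (mu_le_walkProb hp.le hp1 hv).trans (walkProb_hit_le hp hp' n v)
  have huv : 2 * t ≤ u + v := by
    obtain ⟨i, -, hi⟩ := h.exists_le_cnt_add_cnt hA₀ hB₀
    have := huA i
    have := hvB i
    omega
  have huv' : u + v = 2 * t := by
    refine le_antisymm ?_ huv
    by_contra! hcon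
    have h1 : mu p 𝒜 * mu p ℬ ≤ α ^ u * α ^ v := mul_le_mul hAu hBv hB0 (by positivity)
    rw [← pow_add] at h1
    have h2 : α ^ (u + v) ≤ α ^ (2 * t + 1) := pow_le_pow_of_le_one hα.le hα1 hcon
    linarith
  have hAg : (singleHit u 𝒜).Nonempty := by
    rw [nonempty_iff_ne_empty]
    intro he
    have h1 := mu_sdiff_singleHit_le (𝒜 := 𝒜) hp hp' u
    rw [he, sdiff_empty] at h1
    have h2 : mu p 𝒜 * mu p ℬ ≤ 2 * α ^ (u + 1) * α ^ v := mul_le_mul h1 hBv hB0 (by positivity)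
    rw [mul_assoc, ← pow_add, show u + 1 + v = 2 * t + 1 by omega] at h2
    linarith
  have hBg : (singleHit v ℬ).Nonempty := by
    rw [nonempty_iff_ne_empty]
    intro he
    have h1 := mu_sdiff_singleHit_le (𝒜 := ℬ) hp hp' v
    rw [he, sdiff_empty] at h1
    have h2 : mu p 𝒜 * mu p ℬ ≤ α ^ u * (2 * α ^ (v + 1)) := mul_le_mul hAu h1 hB0 (by positivity)
    rw [mul_left_comm, ← pow_add, show u + (v + 1) = 2 * t + 1 by omega] at h2
    linarith
  have hmeet : ∀ A ∈ singleHit u 𝒜, ∀ B ∈ singleHit v ℬ,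
      ∃ i ≤ n, 2 * cnt A i = i + u ∧ 2 * cnt B i = i + v := by
    intro A hA B hB
    obtain ⟨i, hin, hi⟩ :=
      h.exists_le_cnt_add_cnt (singleHit_subset u hA) (singleHit_subset v hB)
    have h1 := le_of_mem_singleHit hA i
    have h2 := le_of_mem_singleHit hB i
    exact ⟨i, hin, by omega, by omega⟩
  obtain ⟨A₁, hA₁⟩ := hAg
  obtain ⟨B₁, hB₁⟩ := hBg
  obtain ⟨m, hmn, hmA, hmB⟩ := hmeet A₁ hA₁ B₁ hB₁
  have hcA := cnt_le A₁ m
  have hcB := cnt_le B₁ m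
  have hAm : ∀ A ∈ singleHit u 𝒜, 2 * cnt A m = m + u := by
    intro A hA
    obtain ⟨i, -, h1, h2⟩ := hmeet A hA B₁ hB₁
    rwa [eq_of_mem_singleHit hB₁ h2.ge hmB.ge] at h1
  have hBm : ∀ B ∈ singleHit v ℬ, 2 * cnt B m = m + v := by
    intro B hB
    obtain ⟨i, -, h1, h2⟩ := hmeet A₁ hA₁ B hB
    rwa [eq_of_mem_singleHit hA₁ h1.ge hmA.ge] at h2
  refine ⟨u, v, m - cnt A₁ m, m - cnt B₁ m, huv', by omega, by omega, hAu, hBv, ?_, ?_⟩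
  · refine (mu_mono hp.le hp1 ?_).trans (mu_sdiff_singleHit_le (𝒜 := 𝒜) hp hp' u)
    refine sdiff_subset_sdiff Subset.rfl fun A hA => ?_
    rw [mem_family, show u + 2 * (m - cnt A₁ m) = m by omega]
    have := hAm A hA
    omega
  · refine (mu_mono hp.le hp1 ?_).trans (mu_sdiff_singleHit_le (𝒜 := ℬ) hp hp' v)
    refine sdiff_subset_sdiff Subset.rfl fun B hB => ?_
    rw [mem_family, show v + 2 * (m - cnt B₁ m) = m by omega]
    have := hBm B hB
    omega

/-- A member of `𝒜` outside `family n u s` excludes a large part of `family n v s'` from `ℬ`, and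
the part is the larger the more frequent such members can be. -/
theorem IsNice.exists_excluded (h : IsNice t 𝒜 ℬ) (hp : 0 < p) (hp' : p ≤ 1 / 2)
    {u v s s' : ℕ} (huv : u + v = 2 * t) (hm : u + 2 * s = v + 2 * s') (hn : u + 2 * s ≤ n)
    (hs' : s' ≤ t) (hne : (𝒜 \ family n u s).Nonempty) :
    ∃ K : ℕ, (1 ≤ K → mu p (𝒜 \ family n u s) ≤ (p / (1 - p)) ^ (u + (K - 1))) ∧
      t.choose s' * p ^ (v + s') * (1 - p) ^ (s' + K) * (1 - p / (1 - p)) ≤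
        mu p (family n v s' \ ℬ) := by
  classical
  have hp1 : p ≤ 1 := by linarith
  -- `K` is minimal such that some exceptional member stays below height `u + K` from time `u + 2s`
  -- on. By minimality, every exceptional member reaches height `u + K - 1`, which bounds their
  -- measure.
  have hex : ∃ K, ∃ A ∈ 𝒜 \ family n u s, ∀ i, u + 2 * s ≤ i → i ≤ n →
      2 * cnt A i < i + u + K := by
    obtain ⟨A, hA⟩ := hne
    refine ⟨n + 1, A, hA, fun i _ hi => ?_⟩
    have := cnt_le A i
    omega
  obtain ⟨A, hA, hAK⟩ := Nat.find_spec hex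
  have hmin := fun k => Nat.find_min hex (m := k)
  set K := Nat.find hex
  have hlow : 1 ≤ K → ∀ A' ∈ 𝒜 \ family n u s, ∃ i, u + 2 * s ≤ i ∧ i ≤ n ∧
      i + u + (K - 1) ≤ 2 * cnt A' i := by
    intro hK A' hA'
    have h1 := hmin (K - 1) (by omega)
    push Not at h1
    exact h1 A' hA'
  have hmiss : ∀ A' ∈ 𝒜 \ family n u s, cnt A' (u + 2 * s) < u + s := by
    intro A' hA'
    rw [mem_sdiff, mem_family, not_le] at hA'
    exact hA'.2
  -- At time `u + 2s` the walk of `A` is below height `u`, so it needs at least `K` further steps to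
  -- reach `u + K - 1`; this leaves room for the block of `K` misses.
  have hKn : u + 2 * s + K ≤ n := by
    rcases Nat.eq_zero_or_pos K with hK | hK
    · omega
    · obtain ⟨i, h1, h2, h3⟩ := hlow hK A hA
      have h4 := hmiss A hA
      have h5 := cnt_le_add_sub A h1
      omega
  refine ⟨K, fun hK => ?_, ?_⟩
  · refine (mu_le_walkProb hp.le hp1 fun A' hA' => ?_).trans
      (walkProb_hit_le hp hp' n (u + (K - 1)))
    obtain ⟨i, -, -, hi⟩ := hlow hK A' hA'
    exact ⟨i, by omega⟩
  -- The full block has length `s + s'` because `t + s + s' = u + 2s`.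
  · have hg := le_walkProb_generic (p := p) hp hp' (n := n) (t := t) (s := s') (b := s + s')
      (K := K) hs' (by omega)
    rw [show t - s' + (s + s') = v + s' by omega] at hg
    refine hg.trans (walkProb_le_mu hp.le hp1 ?_)
    rintro B ⟨h1, h2, h3, h4⟩
    rw [mem_sdiff, mem_family, show v + 2 * s' = t + (s + s') by omega]
    refine ⟨by omega, fun hB => ?_⟩
    obtain ⟨i, hin, hi⟩ := h.exists_le_cnt_add_cnt (mem_sdiff.1 hA).1 hB
    have h5 := hmiss A hA
    rw [show u + 2 * s = t + (s + s') by omega] at h5 hAK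
    have h6 := cnt_le A i
    have h7 := cnt_le B i
    have h8 : t ≤ i := by omega
    -- No time works for `A` and `B`. By time `u + 2s`, `A` has more than `s` misses, and `B` has
    -- its `s'` misses already by time `t`. During the block of `K` misses `B` gains nothing, and
    -- after it `A` is below height `u + K` and `B` at most at `v - K`.
    rcases le_total i (t + (s + s')) with h9 | h9
    · have e1 := cnt_mono A h9
      have e2 := cnt_le_add_sub B h8
      omega
    · have e1 := cnt_le_add_sub A h9
      rcases le_total i (t + (s + s') + K) with h10 | h10
      · have e2 := cnt_mono B h10
        omega
      · obtain ⟨j, rfl⟩ := Nat.exists_eq_add_of_le h10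
        have e2 := h4 j
        have e3 := hAK _ h9 hin
        omega

end Structure

/-! ### Scaled measures, with common order of magnitude `p ^ t` -/

section Scaled

variable {p : ℝ} {n t : ℕ}

/-- The measure of a family, multiplied by `p ^ (t - u)` with an integer exponent. -/
noncomputable def scaledMu (p : ℝ) (t u : ℕ) (𝒜 : Finset (Finset (Fin n))) : ℝ :=
  p ^ ((t : ℤ) - (u : ℤ)) * mu p 𝒜

theorem normSum_eq (u v : ℕ) (𝒜 ℬ : Finset (Finset (Fin n))) :
    normSum p t u v 𝒜 ℬ = scaledMu p t u 𝒜 + scaledMu p t v ℬ := rfl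

theorem zpow_sub_mul_pow (hp : p ≠ 0) (u j : ℕ) :
    p ^ ((t : ℤ) - (u : ℤ)) * p ^ (u + j) = p ^ t * p ^ j := by
  rw [← zpow_natCast p (u + j), ← zpow_add₀ hp, ← pow_add, ← zpow_natCast]
  congr 1
  push_cast
  ring

theorem scaledMu_nonneg (hp : 0 ≤ p) (hp' : p ≤ 1) (u : ℕ) (𝒜 : Finset (Finset (Fin n))) :
    0 ≤ scaledMu p t u 𝒜 := mul_nonneg (zpow_nonneg hp _) (mu_nonneg hp hp' _)

theorem scaledMu_mono (hp : 0 ≤ p) (hp' : p ≤ 1) (u : ℕ) {𝒜 ℬ : Finset (Finset (Fin n))}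
    (h : 𝒜 ⊆ ℬ) : scaledMu p t u 𝒜 ≤ scaledMu p t u ℬ :=
  mul_le_mul_of_nonneg_left (mu_mono hp hp' h) (zpow_nonneg hp _)

theorem scaledMu_union_le (hp : 0 ≤ p) (hp' : p ≤ 1) (u : ℕ) (𝒜 ℬ : Finset (Finset (Fin n))) :
    scaledMu p t u (𝒜 ∪ ℬ) ≤ scaledMu p t u 𝒜 + scaledMu p t u ℬ := by
  unfold scaledMu
  rw [← mul_add]
  exact mul_le_mul_of_nonneg_left (mu_union_le hp hp' _ _) (zpow_nonneg hp _)

theorem scaledMu_inter_add_sdiff (u : ℕ) (𝒜 ℬ : Finset (Finset (Fin n))) :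
    scaledMu p t u (𝒜 ∩ ℬ) + scaledMu p t u (𝒜 \ ℬ) = scaledMu p t u 𝒜 := by
  unfold scaledMu
  rw [← mul_add, mu_inter_add_mu_sdiff]

theorem scaledMu_symmDiff (u : ℕ) (𝒜 ℬ : Finset (Finset (Fin n))) :
    scaledMu p t u (symmDiff 𝒜 ℬ) = scaledMu p t u (𝒜 \ ℬ) + scaledMu p t u (ℬ \ 𝒜) := by
  unfold scaledMu
  rw [← mul_add, mu_symmDiff]

theorem scaledMu_eq_zero_iff (hp : 0 < p) (hp' : p < 1) {u : ℕ} {𝒜 : Finset (Finset (Fin n))} :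
    scaledMu p t u 𝒜 = 0 ↔ 𝒜 = ∅ := by
  rw [scaledMu, mul_eq_zero, or_iff_right (zpow_pos hp _).ne', mu_eq_zero_iff hp hp']

/-- The exponents `t - u` and `t - v` cancel, so products may be estimated on the common scale. -/
theorem scaledMu_mul_scaledMu (hp : p ≠ 0) {u v : ℕ} (huv : u + v = 2 * t)
    (𝒜 ℬ : Finset (Finset (Fin n))) :
    scaledMu p t u 𝒜 * scaledMu p t v ℬ = mu p 𝒜 * mu p ℬ := by
  unfold scaledMu
  rw [mul_mul_mul_comm, ← zpow_add₀ hp]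
  have : (t : ℤ) - u + (t - v) = 0 := by
    have : (u : ℤ) + v = 2 * t := by exact_mod_cast huv
    linarith
  rw [this, zpow_zero, one_mul]

theorem scaledMu_le_of_mu_le (hp : 0 < p) {u j : ℕ} {c : ℝ} {𝒜 : Finset (Finset (Fin n))}
    (h : mu p 𝒜 ≤ c * p ^ (u + j)) : scaledMu p t u 𝒜 ≤ c * p ^ j * p ^ t := by
  calc scaledMu p t u 𝒜 ≤ p ^ ((t : ℤ) - (u : ℤ)) * (c * p ^ (u + j)) :=
        mul_le_mul_of_nonneg_left h (zpow_nonneg hp.le _)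
    _ = c * (p ^ ((t : ℤ) - (u : ℤ)) * p ^ (u + j)) := by ring
    _ = _ := by rw [zpow_sub_mul_pow hp.ne']; ring

theorem le_scaledMu_of_le_mu (hp : 0 < p) {u j : ℕ} {c : ℝ} {𝒜 : Finset (Finset (Fin n))}
    (h : c * p ^ (u + j) ≤ mu p 𝒜) : c * p ^ j * p ^ t ≤ scaledMu p t u 𝒜 := by
  calc c * p ^ j * p ^ t = c * (p ^ ((t : ℤ) - (u : ℤ)) * p ^ (u + j)) := by
        rw [zpow_sub_mul_pow hp.ne']; ring
    _ = p ^ ((t : ℤ) - (u : ℤ)) * (c * p ^ (u + j)) := by ring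
    _ ≤ _ := mul_le_mul_of_nonneg_left h (zpow_nonneg hp.le _)

theorem scaledMu_family_le (hp : 0 < p) (hp' : p ≤ 1) (u s : ℕ) :
    scaledMu p t u (family n u s) ≤ (u + 2 * s).choose s * p ^ s * p ^ t :=
  scaledMu_le_of_mu_le hp (mu_family_le hp hp' n u s)

theorem le_scaledMu_family (hp : 0 < p) (hp' : p ≤ 1) {u s : ℕ} (hn : u + 2 * s ≤ n) :
    (u + 2 * s).choose s * p ^ s * (1 - p) ^ s * p ^ t ≤ scaledMu p t u (family n u s) := by
  have h := le_mu_family hp hp' hn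
  rw [mul_right_comm] at h
  have h2 := le_scaledMu_of_le_mu (t := t) hp h
  rwa [mul_right_comm _ (p ^ s)]

end Scaled

/-! ### From small excess to the three conclusions -/

section Algebra

/-- If `x` exceeds `f` by less than a small multiple of the deficit of `y` against `g`, and vice
versa, then the product is at most `f * g`. -/
theorem mul_le_mul_of_small_excess {f g a a' b b' η : ℝ} (hf : 0 < f)
    (ha' : 0 ≤ a') (hb' : 0 ≤ b') (haf : a' ≤ f) (hbg : b' ≤ g) (hη : 0 ≤ η) (hη' : η ≤ 1 / 4)
    (ha0 : 0 ≤ a) (hb0 : 0 ≤ b)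
    (ha : a ≤ η * b') (hb : b ≤ η * a') (hfg : η * f ≤ g / 4) (hgf : η * g ≤ f / 4) :
    (f + a - a') * (g + b - b') + (a' * g + b' * f) / 8 ≤ f * g := by
  have h1 : (f + a - a') * (g + b - b') ≤ (f + η * b' - a') * (g + η * a' - b') := by
    apply mul_le_mul <;> nlinarith
  have h2 : a' * b' ≤ a' * g := mul_le_mul_of_nonneg_left hbg ha'
  have h3 : a' * b' ≤ b' * f := by nlinarith
  have h4 : a' * (η * f) ≤ a' * (g / 4) := mul_le_mul_of_nonneg_left hfg ha'
  have h5 : b' * (η * g) ≤ b' * (f / 4) := mul_le_mul_of_nonneg_left hgf hb'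
  have h6 : 0 ≤ η * (a' ^ 2 + b' ^ 2) := by positivity
  have h7 : η ^ 2 * (a' * b') ≤ 1 / 16 * (a' * b') := by
    apply mul_le_mul_of_nonneg_right _ (by positivity)
    nlinarith
  nlinarith

variable {p : ℝ} {n t : ℕ} {𝒜 ℬ : Finset (Finset (Fin n))}

/-- As `η ≤ ε₁ < 1/2`, the sum and the symmetric-difference estimate are linear consequences. For
the product, the slack term of `mul_le_mul_of_small_excess` vanishes only if both deficits do, and
then both excesses vanish too, which settles equality. -/
theorem conclusions_of_small_excess (hp : 0 < p) (hp' : p < 1) {u v s s' : ℕ}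
    (huv : u + v = 2 * t) {ε₁ η : ℝ} (hη : 0 < η) (hηε : η ≤ ε₁) (hε : ε₁ < 1 / 2)
    (hη' : η ≤ 1 / 4)
    (hA : scaledMu p t u (𝒜 \ family n u s) ≤ η * scaledMu p t v (family n v s' \ ℬ))
    (hB : scaledMu p t v (ℬ \ family n v s') ≤ η * scaledMu p t u (family n u s \ 𝒜))
    (hF : 0 < scaledMu p t u (family n u s)) (hG : 0 < scaledMu p t v (family n v s'))
    (hFG : η * scaledMu p t u (family n u s) ≤ scaledMu p t v (family n v s') / 4)
    (hGF : η * scaledMu p t v (family n v s') ≤ scaledMu p t u (family n u s) / 4) :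
    Conclusions p ε₁ t u v s s' 𝒜 ℬ := by
  have eA := scaledMu_inter_add_sdiff (p := p) (t := t) u 𝒜 (family n u s)
  have eB := scaledMu_inter_add_sdiff (p := p) (t := t) v ℬ (family n v s')
  have eF := scaledMu_inter_add_sdiff (p := p) (t := t) u (family n u s) 𝒜
  have eG := scaledMu_inter_add_sdiff (p := p) (t := t) v (family n v s') ℬ
  rw [inter_comm] at eF eG
  have nA := scaledMu_nonneg (t := t) hp.le hp'.le u (𝒜 \ family n u s)
  have nB := scaledMu_nonneg (t := t) hp.le hp'.le v (ℬ \ family n v s')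
  have nF := scaledMu_nonneg (t := t) hp.le hp'.le u (family n u s \ 𝒜)
  have nG := scaledMu_nonneg (t := t) hp.le hp'.le v (family n v s' \ ℬ)
  have nAF := scaledMu_nonneg (t := t) hp.le hp'.le u (𝒜 ∩ family n u s)
  have nBG := scaledMu_nonneg (t := t) hp.le hp'.le v (ℬ ∩ family n v s')
  have hprod := mul_le_mul_of_small_excess hF nF nG (by linarith) (by linarith) hη.le hη' nA nB
    hA hB hFG hGF
  have hkey : scaledMu p t u (family n u s \ 𝒜) = 0 → scaledMu p t v (family n v s' \ ℬ) = 0 →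
      𝒜 = family n u s ∧ ℬ = family n v s' := by
    intro h1 h2
    rw [h2, mul_zero] at hA
    rw [h1, mul_zero] at hB
    have h3 := le_antisymm hA nA
    have h4 := le_antisymm hB nB
    rw [scaledMu_eq_zero_iff hp hp', sdiff_eq_empty_iff_subset] at h1 h2 h3 h4
    exact ⟨Subset.antisymm h3 h1, Subset.antisymm h4 h2⟩
  have hhalf : ∀ x : ℝ, 0 ≤ x → η * x ≤ x / 2 := fun x hx => by nlinarith
  rw [show scaledMu p t u (family n u s) + scaledMu p t u (𝒜 \ family n u s) -
      scaledMu p t u (family n u s \ 𝒜) = scaledMu p t u 𝒜 by linarith,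
    show scaledMu p t v (family n v s') + scaledMu p t v (ℬ \ family n v s') -
      scaledMu p t v (family n v s' \ ℬ) = scaledMu p t v ℬ by linarith,
    scaledMu_mul_scaledMu hp.ne' huv 𝒜 ℬ,
    scaledMu_mul_scaledMu hp.ne' huv (family n u s) (family n v s')] at hprod
  have hpos1 : 0 ≤ scaledMu p t u (family n u s \ 𝒜) * scaledMu p t v (family n v s') := by
    positivity
  have hpos2 : 0 ≤ scaledMu p t v (family n v s' \ ℬ) * scaledMu p t u (family n u s) := by
    positivity
  have hh1 := hhalf _ nF
  have hh2 := hhalf _ nG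
  refine ⟨?_, ⟨fun h => ?_, ?_⟩, ?_, by linarith, ⟨fun h => ?_, ?_⟩⟩
  · rw [normSum_eq, normSum_eq]
    linarith
  · rw [normSum_eq, normSum_eq] at h
    exact hkey (by linarith) (by linarith)
  · rintro ⟨h1, h2⟩
    rw [← h1, ← h2]
  · rw [normSum_eq, normSum_eq, scaledMu_symmDiff, scaledMu_symmDiff]
    have h1 : η * scaledMu p t v (family n v s' \ ℬ) ≤ ε₁ * scaledMu p t v (family n v s' \ ℬ) :=
      mul_le_mul_of_nonneg_right hηε nG
    have h2 : η * scaledMu p t u (family n u s \ 𝒜) ≤ ε₁ * scaledMu p t u (family n u s \ 𝒜) :=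
      mul_le_mul_of_nonneg_right hηε nF
    have h3 : 0 ≤ ε₁ * (scaledMu p t u (𝒜 \ family n u s) + scaledMu p t v (ℬ \ family n v s')) :=
      mul_nonneg (by linarith) (by linarith)
    linarith
  · refine hkey ?_ ?_
    · have : scaledMu p t u (family n u s \ 𝒜) * scaledMu p t v (family n v s') = 0 := by linarith
      exact (mul_eq_zero.1 this).resolve_right hG.ne'
    · have : scaledMu p t v (family n v s' \ ℬ) * scaledMu p t u (family n u s) = 0 := by linarith
      exact (mul_eq_zero.1 this).resolve_right hF.ne'
  · rintro ⟨h1, h2⟩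
    rw [← h1, ← h2]

end Algebra

/-! ### Main terms `binom(m, k) p ^ k` in the parameter range -/

/-- The range of the parameters: `t` is large, and `t p` lies about between `r` and `r + 1`. -/
structure Regime (r : ℕ) (γ p : ℝ) (t : ℕ) : Prop where
  pos : 0 < p
  le_half : p ≤ 1 / 2
  le_mul : γ ≤ t * p
  upper : p * (t + 2 * r + 1) ≤ r + 1
  lower : (r : ℝ) ≤ p * (t + 2 * r - 1)
  le_t : 2 * r + 2 ≤ t

/-- The main term `binom(m, k) p ^ k` of the scaled measure of an extremal family. -/
noncomputable def coeff (p : ℝ) (m k : ℕ) : ℝ := m.choose k * p ^ k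

/-- A bound for all main terms that matter. -/
noncomputable def coeffBound (r : ℕ) : ℝ := (3 * r + 3) ^ (r + 1)

/-- A bound for `(1 - p) ^ (-k)` for `k ≤ 2 t + 1`. -/
noncomputable def oddsBound (r : ℕ) : ℝ := Real.exp (4 * r + 5)

theorem oddsBound_pos (r : ℕ) : 0 < oddsBound r := Real.exp_pos _

theorem one_le_coeffBound (r : ℕ) : 1 ≤ coeffBound r :=
  one_le_pow₀ (by have : (0 : ℝ) ≤ r := Nat.cast_nonneg r; linarith)

theorem coeff_nonneg {p : ℝ} (hp : 0 ≤ p) (m k : ℕ) : 0 ≤ coeff p m k := by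
  unfold coeff
  positivity

theorem coeff_mono {p : ℝ} (hp : 0 ≤ p) {m m' : ℕ} (h : m ≤ m') (k : ℕ) :
    coeff p m k ≤ coeff p m' k := by
  unfold coeff
  gcongr

namespace Regime

variable {r t : ℕ} {γ p : ℝ} (h : Regime r γ p t)
include h

theorem mul_le : t * p ≤ r + 1 := by
  have h1 := h.upper
  have h2 : (0 : ℝ) ≤ p * (2 * r + 1) := mul_nonneg h.pos.le (by positivity)
  linarith

theorem odds_pos : 0 < p / (1 - p) := div_pos h.pos (by linarith [h.le_half])

theorem odds_le : p / (1 - p) ≤ 2 * p := by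
  have := h.le_half
  rw [div_le_iff₀ (by linarith)]
  nlinarith [h.pos]

theorem odds_pow_le {k : ℕ} (hk : k ≤ 2 * t + 1) :
    (p / (1 - p)) ^ k ≤ oddsBound r * p ^ k := by
  have hp := h.pos
  have hp' := h.le_half
  have hq : 0 < 1 - p := by linarith
  rw [div_eq_inv_mul, mul_pow]
  refine mul_le_mul_of_nonneg_right ?_ (by positivity)
  have h1 : (1 - p)⁻¹ ≤ Real.exp (2 * p) := by
    refine le_trans ?_ (Real.add_one_le_exp (2 * p))
    rw [inv_le_iff_one_le_mul₀ hq]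
    nlinarith
  calc ((1 - p)⁻¹) ^ k ≤ (Real.exp (2 * p)) ^ k := pow_le_pow_left₀ (by positivity) h1 _
    _ = Real.exp (k * (2 * p)) := (Real.exp_nat_mul _ _).symm
    -- Here `2p(2t + 1) = 4tp + 2p ≤ 4(r + 1) + 1`.
    _ ≤ oddsBound r := by
      apply Real.exp_le_exp.2
      have hk' : (k : ℝ) ≤ 2 * t + 1 := by exact_mod_cast hk
      have := h.mul_le
      nlinarith

theorem coeff_le_coeffBound {m k : ℕ} (hm : m ≤ t + 2 * r + 2) (hk : k ≤ r + 1) :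
    coeff p m k ≤ coeffBound r := by
  have hp := h.pos
  have hm' : (m : ℝ) * p ≤ 3 * r + 3 := by
    have h1 : (m : ℝ) ≤ t + 2 * r + 2 := by exact_mod_cast hm
    have h2 := h.mul_le
    have h3 : (2 * r + 2 : ℝ) * p ≤ 2 * r + 2 := by
      have := h.le_half
      have : (0 : ℝ) ≤ 2 * r + 2 := by positivity
      nlinarith
    nlinarith
  have hc : (m.choose k : ℝ) ≤ (m : ℝ) ^ k := by exact_mod_cast Nat.choose_le_pow m k
  calc coeff p m k ≤ (m : ℝ) ^ k * p ^ k := mul_le_mul_of_nonneg_right hc (by positivity)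
    _ = (m * p) ^ k := (mul_pow _ _ _).symm
    _ ≤ (3 * r + 3 : ℝ) ^ k := pow_le_pow_left₀ (by positivity) hm' _
    _ ≤ _ := pow_le_pow_right₀ (by have : (0 : ℝ) ≤ r := Nat.cast_nonneg r; linarith) hk

/-- By Pascal's rule, each unit added to the upper index costs a smaller main term times `p`, at
most `coeffBound r * p`. Thus `m` may be replaced by `t` at cost `O(p)`. -/
theorem coeff_le_coeff_add {m k : ℕ} (hm' : m ≤ t + 2 * r + 2)
    (hk : k ≤ r + 1) : coeff p m k ≤ coeff p t k + (2 * r + 2) * coeffBound r * p := by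
  have hp := h.pos
  have hD := one_le_coeffBound r
  rcases le_total m t with hm | hm
  · have := coeff_mono hp.le hm k
    have : 0 ≤ (2 * r + 2) * coeffBound r * p := by positivity
    linarith
  obtain ⟨j, rfl⟩ := Nat.exists_eq_add_of_le hm
  have hj : (j : ℝ) ≤ 2 * r + 2 := by exact_mod_cast (show j ≤ 2 * r + 2 by omega)
  suffices H : coeff p (t + j) k ≤ coeff p t k + j * coeffBound r * p by
    have : (j : ℝ) * (coeffBound r * p) ≤ (2 * r + 2) * (coeffBound r * p) :=
      mul_le_mul_of_nonneg_right hj (by positivity)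
    linarith
  clear hj
  rcases k with _ | k
  · simp only [coeff, Nat.choose_zero_right, pow_zero, mul_one, Nat.cast_one]
    have : 0 ≤ j * coeffBound r * p := by positivity
    linarith
  induction j with
  | zero => simp
  | succ j ih =>
    have h1 := ih (by omega) (by omega)
    have h2 := h.coeff_le_coeffBound (m := t + j) (k := k) (by omega) (by omega)
    have h3 : coeff p (t + (j + 1)) (k + 1) = coeff p (t + j) k * p + coeff p (t + j) (k + 1) := by
      unfold coeff
      rw [← add_assoc, Nat.choose_succ_succ']
      push_cast
      ring
    have h4 := mul_le_mul_of_nonneg_right h2 hp.le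
    push_cast
    linarith

theorem le_coeff (hγ : 0 < γ) (hγ' : γ ≤ 1) (hsmall : (r + 1) * p ≤ γ / 2) {k : ℕ}
    (hk : k ≤ r + 1) : (γ / 2) ^ (r + 1) / (r + 1).factorial ≤ coeff p t k := by
  have hp := h.pos
  have ht := h.le_t
  have h1 : ((t + 1 - k : ℕ) : ℝ) ^ k / k.factorial ≤ t.choose k := Nat.pow_le_choose k t
  have h2 : γ / 2 ≤ ((t + 1 - k : ℕ) : ℝ) * p := by
    rw [Nat.cast_sub (by omega)]
    push_cast
    have hk' : (k : ℝ) ≤ r + 1 := by exact_mod_cast hk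
    have := h.le_mul
    nlinarith
  have hf : ((k.factorial : ℕ) : ℝ) ≤ ((r + 1).factorial : ℕ) := by
    exact_mod_cast Nat.factorial_le hk
  have hf0 : (0 : ℝ) < k.factorial := by exact_mod_cast Nat.factorial_pos k
  calc (γ / 2) ^ (r + 1) / (r + 1).factorial ≤ (γ / 2) ^ k / k.factorial := by
        apply div_le_div₀ (by positivity) _ hf0 hf
        exact pow_le_pow_of_le_one (by positivity) (by linarith) hk
    _ ≤ (((t + 1 - k : ℕ) : ℝ) * p) ^ k / k.factorial := by
        apply div_le_div_of_nonneg_right _ hf0.le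
        exact pow_le_pow_left₀ (by positivity) h2 _
    _ = ((t + 1 - k : ℕ) : ℝ) ^ k / k.factorial * p ^ k := by rw [mul_pow]; ring
    _ ≤ coeff p t k := mul_le_mul_of_nonneg_right h1 (by positivity)

omit h in
theorem coeff_succ_mul {k : ℕ} (hk : k ≤ t) :
    coeff p t (k + 1) * (k + 1) = coeff p t k * (p * (t - k)) := by
  have h1 := Nat.choose_succ_right_eq t k
  have h2 : (t.choose (k + 1) : ℝ) * (k + 1) = t.choose k * (t - k) := by
    rw [← Nat.cast_sub hk]
    exact_mod_cast h1
  unfold coeff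
  rw [pow_succ]
  linear_combination p ^ k * p * h2

theorem coeff_succ_le : coeff p t (r + 1) ≤ coeff p t r := by
  have h1 := coeff_succ_mul (p := p) (t := t) (k := r) (by linarith [h.le_t])
  have h2 := coeff_nonneg h.pos.le t r
  have h3 := h.mul_le
  have hp := h.pos
  have hr : (0 : ℝ) ≤ r := Nat.cast_nonneg r
  have h4 : p * (t - r) ≤ r + 1 := by nlinarith
  have h5 : coeff p t (r + 1) * (r + 1) ≤ coeff p t r * (r + 1) := by
    rw [h1]
    exact mul_le_mul_of_nonneg_left h4 h2
  exact le_of_mul_le_mul_right h5 (by positivity)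

/-- The ratio of consecutive terms is `p(t - k)/(k + 1)`, and the lower end of the range for `p`
gives `p(t - k) ≥ r - 3rp`. -/
theorem coeff_le_of_lt {k : ℕ} (hk : k < r) :
    coeff p t k ≤ (k + 1) / r * coeff p t (k + 1) + 3 * coeffBound r * p := by
  have hp := h.pos
  have h1 := coeff_succ_mul (p := p) (t := t) (k := k) (by have := h.le_t; omega)
  have h2 := h.coeff_le_coeffBound (m := t) (k := k) (by omega) (by omega)
  have h0 := coeff_nonneg hp.le t k
  have h3 := h.lower
  have hr : (0 : ℝ) < r := by exact_mod_cast (by omega : 0 < r)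
  have hk' : (k : ℝ) + 1 ≤ r := by exact_mod_cast hk
  have h4 : r - 3 * r * p ≤ p * (t - k) := by nlinarith
  have h5 : coeff p t k * (r - 3 * r * p) ≤ coeff p t (k + 1) * (k + 1) := by
    rw [h1]
    exact mul_le_mul_of_nonneg_left h4 h0
  have h6 : coeff p t k * (3 * r * p) ≤ coeffBound r * (3 * r * p) :=
    mul_le_mul_of_nonneg_right h2 (by positivity)
  have h7 : coeff p t k * r ≤ ((k + 1) / r * coeff p t (k + 1) + 3 * coeffBound r * p) * r := by
    have e : ((k + 1) / r * coeff p t (k + 1) + 3 * coeffBound r * p) * r =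
        coeff p t (k + 1) * (k + 1) + coeffBound r * (3 * r * p) := by
      field_simp
    rw [e]
    linarith
  exact le_of_mul_le_mul_right h7 hr

/-- Like Poisson weights with mean between `r` and `r + 1`, the terms peak at `r`, up to `O(p)`. -/
theorem coeff_le_coeff_r {k : ℕ} (hk : k ≤ r + 1) :
    coeff p t k ≤ coeff p t r + 3 * r * coeffBound r * p := by
  have hp := h.pos
  have hD := one_le_coeffBound r
  have hd : 0 ≤ coeffBound r * p := by positivity
  rcases Nat.lt_or_ge r k with hk1 | hk1
  · obtain rfl : k = r + 1 := by omega
    have := h.coeff_succ_le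
    have : 0 ≤ 3 * r * coeffBound r * p := by positivity
    linarith
  · suffices H : ∀ j, j ≤ r → coeff p t (r - j) ≤ coeff p t r + 3 * j * (coeffBound r * p) by
      have h1 := H (r - k) (by omega)
      rw [Nat.sub_sub_self hk1] at h1
      have h2 : ((r - k : ℕ) : ℝ) ≤ r := by exact_mod_cast Nat.sub_le r k
      have h3 := mul_le_mul_of_nonneg_right h2 hd
      linarith
    intro j hj
    induction j with
    | zero => simp
    | succ j ih =>
      have h1 := ih (by omega)
      have h2 := h.coeff_le_of_lt (k := r - (j + 1)) (by omega)
      rw [show r - (j + 1) + 1 = r - j by omega] at h2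
      have h3 : ((((r - (j + 1) : ℕ) : ℝ) + 1) / r) ≤ 1 := by
        have hr : (0 : ℝ) < r := by exact_mod_cast (by omega : 0 < r)
        rw [div_le_one hr]
        exact_mod_cast (by omega : r - (j + 1) + 1 ≤ r)
      have h4 := mul_le_mul_of_nonneg_right h3 (coeff_nonneg hp.le t (r - j))
      push_cast at h1 ⊢
      linarith

/-- Log-concavity with the factor `r/(r+1)`, weakened to `(r+1)/(r+2)`. It serves for the pair `(r +
1, r - 1)`. -/
theorem coeff_succ_mul_coeff_pred {k : ℕ} (hk : r = k + 1) :
    coeff p t (r + 1) * coeff p t k ≤ (r + 1) / (r + 2) * coeff p t r ^ 2 := by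
  subst hk
  have hp := h.pos
  have ht := h.le_t
  have h1 := coeff_succ_mul (p := p) (t := t) (k := k) (by omega)
  have h2 := coeff_succ_mul (p := p) (t := t) (k := k + 1) (by omega)
  have ha := coeff_nonneg hp.le t k
  have hb := coeff_nonneg hp.le t (k + 1)
  have hc := coeff_nonneg hp.le t (k + 1 + 1)
  push_cast at *
  set a := coeff p t k
  set b := coeff p t (k + 1)
  set c := coeff p t (k + 1 + 1)
  have htk : (2 * ((k : ℝ) + 1) + 2) ≤ t := by exact_mod_cast ht
  have hk0 : (0 : ℝ) ≤ k := Nat.cast_nonneg k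
  have hx : 0 < p * (t - k) := mul_pos hp (by linarith)
  have e1 : a = b * (k + 1) / (p * (t - k)) := by
    rw [eq_div_iff hx.ne']
    exact h1.symm
  have e2 : c = b * (p * (t - (k + 1))) / (k + 1 + 1) := by
    rw [eq_div_iff (by positivity)]
    exact h2
  have e3 : c * a = b ^ 2 * ((k + 1) / (k + 1 + 1)) * ((t - (k + 1)) / (t - k)) := by
    rw [e1, e2]
    have : (t : ℝ) - k ≠ 0 := by linarith
    field_simp
  have e4 : (t - (k + 1 : ℝ)) / (t - k) ≤ 1 := by
    rw [div_le_one (by linarith)]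
    linarith
  have e5 : ((k : ℝ) + 1) / (k + 1 + 1) ≤ (k + 1 + 1) / (k + 1 + 2) := by
    rw [div_le_div_iff₀ (by positivity) (by positivity)]
    nlinarith
  calc c * a ≤ b ^ 2 * ((k + 1) / (k + 1 + 1)) * 1 := by
        rw [e3]
        exact mul_le_mul_of_nonneg_left e4 (by positivity)
    _ ≤ _ := by
        rw [mul_one, mul_comm]
        exact mul_le_mul_of_nonneg_right e5 (by positivity)

end Regime

/-! ### Products of main terms inside and outside `R_ex` -/

/-- The main term of the product of the measures of the extremal families for `(s, s')`. -/
noncomputable def prodCoeff (p : ℝ) (t s s' : ℕ) : ℝ :=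
  coeff p (t + s + s') s * coeff p (t + s + s') s'

theorem prodCoeff_comm (p : ℝ) (t s s' : ℕ) : prodCoeff p t s s' = prodCoeff p t s' s := by
  unfold prodCoeff
  rw [mul_comm, add_right_comm]

theorem prodCoeff_nonneg {p : ℝ} (hp : 0 ≤ p) (t s s' : ℕ) : 0 ≤ prodCoeff p t s s' :=
  mul_nonneg (coeff_nonneg hp _ _) (coeff_nonneg hp _ _)

theorem prodCoeff_succ_mul (p : ℝ) (t s s' : ℕ) :
    prodCoeff p t (s + 1) s' * ((s + 1) * (t + s + 1)) =
      prodCoeff p t s s' * (p * (t + s + s' + 1) ^ 2) := by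
  have h1 : ((t + s + s' : ℕ) + 1 : ℝ) * (t + s + s').choose s =
      (t + s + s' + 1).choose (s + 1) * (s + 1) := by
    exact_mod_cast Nat.add_one_mul_choose_eq (t + s + s') s
  have h2 : ((t + s + s').choose s' : ℝ) * ((t + s + s' : ℕ) + 1) =
      (t + s + s' + 1).choose s' * (t + s + 1) := by
    have := Nat.choose_mul_succ_eq (t + s + s') s'
    rw [show t + s + s' + 1 - s' = t + s + 1 by omega] at this
    exact_mod_cast this
  unfold prodCoeff coeff
  rw [show t + (s + 1) + s' = t + s + s' + 1 by omega]
  push_cast at h1 h2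
  calc _ = ((t + s + s' + 1).choose (s + 1) * (s + 1 : ℝ)) *
        ((t + s + s' + 1).choose s' * (t + s + 1 : ℝ)) * (p ^ (s + 1) * p ^ s') := by ring
    _ = _ := by
        rw [← h1, ← h2]
        ring

namespace Regime

variable {r t : ℕ} {γ p : ℝ} (h : Regime r γ p t)
include h

/-- The ratio is about `tp/(s + 1) ≤ (r + 1)/(r + 2)`. The correction `4p` is uniform in `s`,
because with `x = s + 1` one has `(t + 2x)² ≤ (t + x)(t + 4x)`. -/
theorem prodCoeff_succ_le {s s' : ℕ} (hs : r + 1 ≤ s) (hs' : s' ≤ s + 1) :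
    prodCoeff p t (s + 1) s' ≤ ((r + 1) / (r + 2) + 4 * p) * prodCoeff p t s s' := by
  have hp := h.pos
  have h1 := prodCoeff_succ_mul p t s s'
  have h0 := prodCoeff_nonneg hp.le t s s'
  have hx : (r : ℝ) + 2 ≤ s + 1 := by
    have : (r : ℝ) + 1 ≤ s := by exact_mod_cast hs
    linarith
  have hs'' : (s' : ℝ) ≤ s + 1 := by exact_mod_cast hs'
  have htp := h.mul_le
  have hr : (0 : ℝ) ≤ r := Nat.cast_nonneg r
  have ht : (0 : ℝ) ≤ t := Nat.cast_nonneg t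
  have hs0 : (0 : ℝ) ≤ s' := Nat.cast_nonneg s'
  set x : ℝ := s + 1 with hxdef
  have e1 : (t + s + s' + 1 : ℝ) ^ 2 ≤ (t + x) * (t + 4 * x) := by
    have : (t + s + s' + 1 : ℝ) ^ 2 ≤ (t + 2 * x) ^ 2 :=
      pow_le_pow_left₀ (by positivity) (by linarith) 2
    nlinarith
  have e2 : p * (t + 4 * x) ≤ ((r + 1) / (r + 2) + 4 * p) * x := by
    have : (r : ℝ) + 1 ≤ (r + 1) / (r + 2) * x := by
      rw [div_mul_eq_mul_div, le_div_iff₀ (by positivity)]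
      nlinarith
    nlinarith
  have e3 : p * (t + s + s' + 1 : ℝ) ^ 2 ≤ ((r + 1) / (r + 2) + 4 * p) * (x * (t + s + 1)) := by
    have h2 := mul_le_mul_of_nonneg_left e1 hp.le
    have h3 := mul_le_mul_of_nonneg_left e2 (show 0 ≤ t + x by linarith)
    rw [show (t : ℝ) + s + 1 = t + x by rw [hxdef]; ring]
    linarith
  have hpos : 0 < x * (t + s + 1 : ℝ) := by
    have : (0 : ℝ) ≤ s := Nat.cast_nonneg s
    positivity
  refine le_of_mul_le_mul_right ?_ hpos
  rw [h1]
  have := mul_le_mul_of_nonneg_left e3 h0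
  linarith

/-- The indices have no a priori bound, so the larger one is lowered step by step until both are at
most `r + 1`; every step has a factor at most `1`, and one factor is kept. -/
theorem prodCoeff_le_of_large (hsmall : 4 * (r + 2) * p ≤ 1) {M : ℝ}
    (hM : ∀ a b, a ≤ r + 1 → b ≤ r + 1 → prodCoeff p t a b ≤ M) {s s' : ℕ}
    (hs : r + 2 ≤ s ∨ r + 2 ≤ s') :
    prodCoeff p t s s' ≤ ((r + 1) / (r + 2) + 4 * p) * M := by
  have hp := h.pos
  have hM0 : 0 ≤ M := (prodCoeff_nonneg hp.le t 0 0).trans (hM 0 0 (by omega) (by omega))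
  have hr : (0 : ℝ) ≤ r := Nat.cast_nonneg r
  have hl0 : 0 ≤ (r + 1 : ℝ) / (r + 2) + 4 * p := by positivity
  have hl1 : (r + 1 : ℝ) / (r + 2) + 4 * p ≤ 1 := by
    rw [div_add' _ _ _ (by positivity), div_le_one (by positivity)]
    linarith
  induction hN : s + s' using Nat.strong_induction_on generalizing s s' with
  | _ N ih =>
  have key : ∀ s s' : ℕ, s + s' = N → s' ≤ s → r + 2 ≤ s →
      prodCoeff p t s s' ≤ ((r + 1) / (r + 2) + 4 * p) * M := by
    intro s s' hN hle hs
    obtain ⟨k, rfl⟩ : ∃ k, s = k + 1 := ⟨s - 1, by omega⟩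
    refine (h.prodCoeff_succ_le (by omega) hle).trans (mul_le_mul_of_nonneg_left ?_ hl0)
    by_cases hb : k ≤ r + 1 ∧ s' ≤ r + 1
    · exact hM _ _ hb.1 hb.2
    · have h1 := ih (k + s') (by omega) (s := k) (s' := s') (by omega) rfl
      nlinarith
  rcases le_total s' s with hle | hle
  · exact key s s' hN hle (by omega)
  · rw [prodCoeff_comm]
    exact key s' s (by omega) hle (by omega)

end Regime

open Filter Topology

theorem eventually_mul_lt (D : ℝ) {θ : ℝ} (hθ : 0 < θ) : ∀ᶠ p in 𝓝[>] (0 : ℝ), D * p < θ := by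
  have h : Tendsto (fun p : ℝ => D * p) (𝓝 0) (𝓝 (D * 0)) := (continuous_const_mul D).tendsto 0
  rw [mul_zero] at h
  exact (h.eventually_lt_const hθ).filter_mono nhdsWithin_le_nhds

theorem mul_le_mul_add {x y a b c d D p : ℝ} (hy : 0 ≤ y) (ha : a ≤ D) (hb : b ≤ D)
    (ha0 : 0 ≤ a) (hc : 0 ≤ c) (hd : 0 ≤ d) (hp : 0 ≤ p) (hp' : p ≤ 1)
    (hxa : x ≤ a + c * p) (hyb : y ≤ b + d * p) :
    x * y ≤ a * b + (D * c + D * d + c * d) * p := by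
  have h1 : x * y ≤ (a + c * p) * (b + d * p) :=
    mul_le_mul hxa hyb hy (by positivity)
  have h2 : a * d ≤ D * d := mul_le_mul_of_nonneg_right ha hd
  have h3 : b * c ≤ D * c := mul_le_mul_of_nonneg_right hb hc
  have h4 : c * d * p ≤ c * d := mul_le_of_le_one_right (by positivity) hp'
  nlinarith

theorem mem_Rex {r s s' : ℕ} : (s, s') ∈ Rex r ↔
    (s ≤ r + 1 ∧ s' ≤ r + 1 ∧ r ≤ s + 1 ∧ r ≤ s' + 1 ∧ s' ≤ s ∧ s ≤ s' + 1) := by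
  unfold Rex
  split_ifs with hr
  · simp only [Set.mem_insert_iff, Set.mem_singleton_iff, Prod.mk.injEq]
    omega
  · simp only [Set.mem_insert_iff, Set.mem_singleton_iff, Prod.mk.injEq]
    omega

namespace Regime

variable {r t : ℕ} {γ p : ℝ}

theorem prodCoeff_le_coeff_mul (h : Regime r γ p t) {a b : ℕ} (ha : a ≤ r + 1) (hb : b ≤ r + 1) :
    prodCoeff p t a b ≤ coeff p t a * coeff p t b +
      (coeffBound r * ((2 * r + 2) * coeffBound r) + coeffBound r * ((2 * r + 2) * coeffBound r) +
        (2 * r + 2) * coeffBound r * ((2 * r + 2) * coeffBound r)) * p := by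
  have hp := h.pos
  have hD : 0 ≤ coeffBound r := zero_le_one.trans (one_le_coeffBound r)
  have hE : 0 ≤ (2 * r + 2) * coeffBound r := by positivity
  exact mul_le_mul_add (coeff_nonneg hp.le _ _)
    (h.coeff_le_coeffBound (by omega) ha) (h.coeff_le_coeffBound (by omega) hb)
    (coeff_nonneg hp.le _ _) hE hE hp.le (by linarith [h.le_half])
    (h.coeff_le_coeff_add (by omega) ha) (h.coeff_le_coeff_add (by omega) hb)

omit r t γ p in
/-- Outside `R_ex` the product of the main terms is smaller than for `(r, r)` by a constant
factor, up to an error of order `p`. -/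
theorem exists_prodCoeff_le (r : ℕ) : ∃ D : ℝ, 0 ≤ D ∧ ∀ {γ p : ℝ} {t : ℕ}, Regime r γ p t →
    4 * (r + 2) * p ≤ 1 → ∀ s s' : ℕ, (s, s') ∉ Rex r → (s', s) ∉ Rex r →
    prodCoeff p t s s' ≤ (r + 1) / (r + 2) * coeff p t r ^ 2 + D * p := by
  have hD : 0 ≤ coeffBound r := zero_le_one.trans (one_le_coeffBound r)
  obtain ⟨D₀, hD₀⟩ : ∃ x, x = coeffBound r := ⟨_, rfl⟩
  rw [← hD₀] at hD
  obtain ⟨E, hE⟩ : ∃ x : ℝ, x = (2 * r + 2) * D₀ := ⟨_, rfl⟩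
  obtain ⟨E', hE'⟩ : ∃ x : ℝ, x = D₀ * E + D₀ * E + E * E := ⟨_, rfl⟩
  obtain ⟨F, hF⟩ : ∃ x : ℝ, x = 3 * r * D₀ := ⟨_, rfl⟩
  obtain ⟨F', hF'⟩ : ∃ x : ℝ, x = F + 3 * D₀ := ⟨_, rfl⟩
  have hE0 : 0 ≤ E := by rw [hE]; positivity
  have hE'0 : 0 ≤ E' := by rw [hE']; positivity
  have hF0 : 0 ≤ F := by rw [hF]; positivity
  have hF'0 : 0 ≤ F' := by rw [hF']; positivity
  obtain ⟨M', hM'⟩ : ∃ x : ℝ, x = D₀ * F + D₀ * F + F * F + E' := ⟨_, rfl⟩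
  have hM'0 : 0 ≤ M' := by rw [hM']; positivity
  refine ⟨(4 * D₀ ^ 2 + 5 * M') + ((D₀ * F' + D₀ * F + F' * F) + E') + E', by positivity, ?_⟩
  intro γ p t h hsmall s s' hR hR'
  have hp := h.pos
  have hp1 : p ≤ 1 := by linarith [h.le_half]
  have hr : (0 : ℝ) ≤ r := Nat.cast_nonneg r
  set B := coeff p t r with hB
  have hB0 : 0 ≤ B := coeff_nonneg hp.le _ _
  have hBD : B ≤ D₀ := hD₀ ▸ h.coeff_le_coeffBound (by omega) (by omega)
  have hκ0 : 0 ≤ ((r : ℝ) + 1) / (r + 2) := by positivity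
  have hκ1 : ((r : ℝ) + 1) / (r + 2) ≤ 1 := by
    rw [div_le_one (by positivity)]
    linarith
  set κ : ℝ := (r + 1) / (r + 2) with hκ
  have hlt : ∀ a, a ≤ r + 1 → coeff p t a ≤ B + F * p := fun a ha => by
    have := h.coeff_le_coeff_r ha
    rwa [← hD₀, ← hF] at this
  have hbase : ∀ a b, a ≤ r + 1 → b ≤ r + 1 → prodCoeff p t a b ≤ B ^ 2 + M' * p := by
    intro a b ha hb
    have h1 := h.prodCoeff_le_coeff_mul ha hb
    rw [← hD₀, ← hE, ← hE'] at h1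
    have h2 := mul_le_mul_add (coeff_nonneg hp.le _ _) hBD hBD hB0 hF0 hF0
      hp.le hp1 (hlt a ha) (hlt b hb)
    rw [hM']
    linarith
  have hp1' : 0 ≤ (4 * D₀ ^ 2 + 5 * M') * p := by positivity
  have hp2' : 0 ≤ ((D₀ * F' + D₀ * F + F' * F) + E') * p := by positivity
  have hp3' : 0 ≤ E' * p := by positivity
  -- There are three ways to leave `R_ex`: an index at least `r + 2`, an index at most `r - 2`, or
  -- the indices `r + 1` and `r - 1`.
  by_cases hlarge : r + 2 ≤ s ∨ r + 2 ≤ s'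
  · have h1 := h.prodCoeff_le_of_large hsmall hbase hlarge
    have h2 : B ^ 2 ≤ D₀ ^ 2 := pow_le_pow_left₀ hB0 hBD 2
    have h3 : (κ + 4 * p) * (B ^ 2 + M' * p) ≤ κ * B ^ 2 + (4 * D₀ ^ 2 + 5 * M') * p := by
      have e1 : p * B ^ 2 ≤ p * D₀ ^ 2 := mul_le_mul_of_nonneg_left h2 hp.le
      have e0 : (κ + 4 * p) * (B ^ 2 + M' * p) =
          κ * B ^ 2 + κ * (M' * p) + 4 * (p * B ^ 2) + 4 * (p * (M' * p)) := by ring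
      have e2 : κ * (M' * p) ≤ 1 * (M' * p) := mul_le_mul_of_nonneg_right hκ1 (by positivity)
      have e3 : p * (M' * p) ≤ 1 * (M' * p) := mul_le_mul_of_nonneg_right hp1 (by positivity)
      rw [e0]
      linarith
    linarith
  · push Not at hlarge
    have hs : s ≤ r + 1 := by omega
    have hs' : s' ≤ r + 1 := by omega
    have hlow : ∀ a b : ℕ, a ≤ r + 1 → b ≤ r + 1 → a + 2 ≤ r →
        prodCoeff p t a b ≤ κ * B ^ 2 + ((D₀ * F' + D₀ * F + F' * F) + E') * p := by
      intro a b ha hb har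
      have h1 := h.prodCoeff_le_coeff_mul ha hb
      rw [← hD₀, ← hE, ← hE'] at h1
      have h2 := h.coeff_le_of_lt (k := a) (by omega)
      rw [← hD₀] at h2
      have h3 := hlt (a + 1) (by omega)
      have hr0 : (0 : ℝ) < r := by exact_mod_cast (by omega : 0 < r)
      have h4 : ((a : ℝ) + 1) / r ≤ κ := by
        rw [hκ, div_le_div_iff₀ hr0 (by positivity)]
        have : (a : ℝ) + 2 ≤ r := by exact_mod_cast har
        nlinarith
      have h5 : coeff p t a ≤ κ * B + F' * p := by
        have e1 : ((a : ℝ) + 1) / r * coeff p t (a + 1) ≤ κ * (B + F * p) :=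
          mul_le_mul h4 h3 (coeff_nonneg hp.le _ _) hκ0
        have e2 : κ * (F * p) ≤ 1 * (F * p) := mul_le_mul_of_nonneg_right hκ1 (by positivity)
        rw [hF']
        linarith
      have h6 := mul_le_mul_add (coeff_nonneg hp.le _ _)
        ((mul_le_of_le_one_left hB0 hκ1).trans hBD) hBD (by positivity) hF'0 hF0 hp.le hp1 h5
        (hlt b hb)
      linarith
    have hmid : ∀ k, r = k + 1 → prodCoeff p t (r + 1) k ≤ κ * B ^ 2 + E' * p := by
      intro k hk
      have h1 := h.prodCoeff_le_coeff_mul (a := r + 1) (b := k) le_rfl (by omega)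
      rw [← hD₀, ← hE, ← hE'] at h1
      have h2 := h.coeff_succ_mul_coeff_pred hk
      linarith
    rw [mem_Rex] at hR hR'
    by_cases c1 : s + 2 ≤ r
    · have := hlow s s' hs hs' c1
      linarith
    by_cases c2 : s' + 2 ≤ r
    · have := hlow s' s hs' hs c2
      rw [prodCoeff_comm]
      linarith
    by_cases c3 : s' ≤ s
    · obtain rfl : s = r + 1 := by omega
      have := hmid s' (by omega)
      linarith
    · obtain rfl : s' = r + 1 := by omega
      have := hmid s (by omega)
      rw [prodCoeff_comm]
      linarith

end Regime

/-! ### Nice pairs with large product, for small `p` -/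

/-- The data of a nice pair with a large product of measures: it is close to the pair
`(family n u s, family n v s')`. -/
structure Aligned (r : ℕ) (p c : ℝ) {n : ℕ} (t u v s s' : ℕ)
    (𝒜 ℬ : Finset (Finset (Fin n))) : Prop where
  add_eq : u + v = 2 * t
  support_eq : u + 2 * s = v + 2 * s'
  support_le : u + 2 * s ≤ n
  left_le : s ≤ r + 1
  right_le : s' ≤ r + 1
  le_left : c * p ^ t ≤ scaledMu p t u 𝒜
  le_right : c * p ^ t ≤ scaledMu p t v ℬ
  excess_left : scaledMu p t u (𝒜 \ family n u s) ≤ 2 * oddsBound r * p * p ^ t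
  excess_right : scaledMu p t v (ℬ \ family n v s') ≤ 2 * oddsBound r * p * p ^ t

theorem Aligned.symm {r n t u v s s' : ℕ} {p c : ℝ} {𝒜 ℬ : Finset (Finset (Fin n))}
    (h : Aligned r p c t u v s s' 𝒜 ℬ) : Aligned r p c t v u s' s ℬ 𝒜 :=
  ⟨by rw [add_comm, h.add_eq], h.support_eq.symm, h.support_eq ▸ h.support_le, h.right_le,
    h.left_le, h.le_right, h.le_left, h.excess_right, h.excess_left⟩

/-- A lower bound for the main terms. -/
noncomputable def coeffLower (r : ℕ) (γ : ℝ) : ℝ := (γ / 2) ^ (r + 1) / (r + 1).factorial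

theorem coeffLower_pos (r : ℕ) {γ : ℝ} (hγ : 0 < γ) : 0 < coeffLower r γ := by
  unfold coeffLower
  positivity

theorem Regime.le_mu_family {r t n : ℕ} {γ p : ℝ} (h : Regime r γ p t) (hn : t + 2 * r ≤ n) :
    coeff p t r * (1 - r * p) * p ^ t ≤ mu p (family n t r) := by
  have hp := h.pos
  have hp' := h.le_half
  have h1 := CrossIntersecting.le_mu_family hp (by linarith) hn
  have h2 : 1 - r * p ≤ (1 - p) ^ r := by
    have := one_add_mul_le_pow (a := -p) (by linarith) r
    rw [← sub_eq_add_neg] at this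
    linarith
  have h3 := coeff_mono hp.le (show t ≤ t + 2 * r by omega) r
  have h4 := coeff_nonneg hp.le t r
  calc coeff p t r * (1 - r * p) * p ^ t ≤ coeff p t r * (1 - p) ^ r * p ^ t := by gcongr
    _ ≤ coeff p (t + 2 * r) r * (1 - p) ^ r * p ^ t := by
        have : 0 ≤ 1 - p := by linarith
        gcongr
    _ = (t + 2 * r).choose r * p ^ (t + r) * (1 - p) ^ r := by
        unfold coeff
        ring
    _ ≤ _ := h1

/-- The hypothesis on the product of the measures yields extremal families with index in `R_ex`. -/
theorem eventually_exists_aligned (r : ℕ) {γ δ₁ : ℝ} (hγ : 0 < γ) (hγ' : γ ≤ 1)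
    (hδ₁ : 0 < δ₁) (hδ₁' : δ₁ < 1 / ((r : ℝ) + 2)) :
    ∀ᶠ p in 𝓝[>] (0 : ℝ), ∀ {t n : ℕ} {𝒜 ℬ : Finset (Finset (Fin n))}, Regime r γ p t →
      t + 2 * r ≤ n → IsNice t 𝒜 ℬ →
      (1 - δ₁) * mu p (family n t r) ^ 2 ≤ mu p 𝒜 * mu p ℬ →
      ∃ u v s s' : ℕ, ((s, s') ∈ Rex r ∨ (s', s) ∈ Rex r) ∧
        Aligned r p (coeffLower r γ ^ 2 / (8 * oddsBound r)) t u v s s' 𝒜 ℬ := by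
  obtain ⟨D, hD0, hD⟩ := Regime.exists_prodCoeff_le r
  have hg := coeffLower_pos r hγ
  have hC := oddsBound_pos r
  have hr : (0 : ℝ) ≤ r := Nat.cast_nonneg r
  have hδhalf : δ₁ < 1 / 2 := hδ₁'.trans_le (by gcongr; linarith)
  have hκ : ((r : ℝ) + 1) / (r + 2) = 1 - 1 / (r + 2) := by field_simp; ring
  filter_upwards [eventually_mul_lt (r + 1) (half_pos hγ),
    eventually_mul_lt (4 * (r + 2)) one_pos, eventually_mul_lt (2 * r) one_pos,
    eventually_mul_lt (2 * oddsBound r) (show 0 < coeffLower r γ ^ 2 / 8 by positivity),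
    -- All errors of order `p` together must stay below the gap between `1 - δ₁` and `(r+1)/(r+2)`,
    -- times the lower bound for the squared main term.
    eventually_mul_lt (D + 8 * oddsBound r ^ 2 + 2 * r * coeffBound r ^ 2)
      (show 0 < (1 / ((r : ℝ) + 2) - δ₁) * coeffLower r γ ^ 2 from
        mul_pos (by linarith) (by positivity))]
    with p hp1 hp2 hp3 hp4 hp5 t n 𝒜 ℬ h hn hnice hμ
  have hp := h.pos
  have hpone : p ≤ 1 := by linarith [h.le_half]
  set C := oddsBound r
  set g := coeffLower r γ
  set B := coeff p t r with hB
  have hgB : g ≤ B := h.le_coeff hγ hγ' hp1.le (by omega)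
  have hBD : B ≤ coeffBound r := h.coeff_le_coeffBound (by omega) (by omega)
  have hY : 0 < p ^ t := pow_pos hp t
  set Y := p ^ t with hYdef
  have hF := h.le_mu_family hn
  have hrp : 0 ≤ r * p := by positivity
  have hB0 : 0 < B := hg.trans_le hgB
  have hF2 : B ^ 2 * (1 - 2 * r * p) * Y ^ 2 ≤ mu p (family n t r) ^ 2 := by
    have h1 : (B * (1 - r * p) * Y) ^ 2 ≤ mu p (family n t r) ^ 2 :=
      pow_le_pow_left₀ (mul_nonneg (mul_nonneg hB0.le (by linarith)) hY.le) hF 2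
    refine le_trans ?_ h1
    rw [mul_pow, mul_pow]
    have : 1 - 2 * r * p ≤ (1 - r * p) ^ 2 := by nlinarith
    gcongr
  have hμlow : (1 - δ₁) * (B ^ 2 * (1 - 2 * r * p) * Y ^ 2) ≤ mu p 𝒜 * mu p ℬ :=
    (mul_le_mul_of_nonneg_left hF2 (by linarith)).trans hμ
  have hF3 : B ^ 2 * (1 / 4) * Y ^ 2 ≤ mu p (family n t r) ^ 2 := by
    have h1 : (B * (1 / 2) * Y) ^ 2 ≤ mu p (family n t r) ^ 2 := by
      refine pow_le_pow_left₀ (by positivity) (le_trans ?_ hF) 2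
      have : (1 : ℝ) / 2 ≤ 1 - r * p := by linarith
      gcongr
    refine le_trans (le_of_eq ?_) h1
    ring
  have hμc : g ^ 2 / 8 * Y ^ 2 ≤ mu p 𝒜 * mu p ℬ := by
    have h1 : g ^ 2 ≤ B ^ 2 := pow_le_pow_left₀ hg.le hgB 2
    have h2 : g ^ 2 * Y ^ 2 ≤ B ^ 2 * Y ^ 2 := mul_le_mul_of_nonneg_right h1 (by positivity)
    have h3 : 0 ≤ mu p (family n t r) ^ 2 := by positivity
    nlinarith
  have hlarge : 2 * (p / (1 - p)) ^ (2 * t + 1) < mu p 𝒜 * mu p ℬ := by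
    have h1 := h.odds_pow_le (k := 2 * t + 1) le_rfl
    have h2 : p ^ (2 * t + 1) = p * Y ^ 2 := by rw [hYdef]; ring
    rw [h2] at h1
    have h3 : 2 * C * p * Y ^ 2 < g ^ 2 / 8 * Y ^ 2 := mul_lt_mul_of_pos_right hp4 (by positivity)
    linarith
  obtain ⟨u, v, s, s', huv, hss, hsn, hA, hB', hAF, hBF⟩ :=
    hnice.exists_families hp h.le_half hlarge
  have hx : scaledMu p t u 𝒜 ≤ C * Y := by
    have := scaledMu_le_of_mu_le (t := t) (u := u) (j := 0) hp
      (hA.trans (h.odds_pow_le (by omega)))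
    simpa using this
  have hy : scaledMu p t v ℬ ≤ C * Y := by
    have := scaledMu_le_of_mu_le (t := t) (u := v) (j := 0) hp
      (hB'.trans (h.odds_pow_le (by omega)))
    simpa using this
  have hxe : scaledMu p t u (𝒜 \ family n u s) ≤ 2 * C * p * Y := by
    have := scaledMu_le_of_mu_le (t := t) (u := u) (j := 1) (c := 2 * C) hp
      (hAF.trans (by rw [mul_assoc]; gcongr; exact h.odds_pow_le (by omega)))
    simpa using this
  have hye : scaledMu p t v (ℬ \ family n v s') ≤ 2 * C * p * Y := by
    have := scaledMu_le_of_mu_le (t := t) (u := v) (j := 1) (c := 2 * C) hp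
      (hBF.trans (by rw [mul_assoc]; gcongr; exact h.odds_pow_le (by omega)))
    simpa using this
  have hxy := scaledMu_mul_scaledMu hp.ne' huv 𝒜 ℬ
  have hx0 := scaledMu_nonneg (t := t) hp.le hpone u 𝒜
  have hy0 := scaledMu_nonneg (t := t) hp.le hpone v ℬ
  have hRex : (s, s') ∈ Rex r ∨ (s', s) ∈ Rex r := by
    by_contra! hcon
    have hG := hD h hp2.le s s' hcon.1 hcon.2
    have ex := scaledMu_inter_add_sdiff (p := p) (t := t) u 𝒜 (family n u s)
    have ey := scaledMu_inter_add_sdiff (p := p) (t := t) v ℬ (family n v s')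
    have nx := scaledMu_nonneg (t := t) hp.le hpone u (𝒜 ∩ family n u s)
    have ny := scaledMu_nonneg (t := t) hp.le hpone v (ℬ ∩ family n v s')
    have nx' := scaledMu_nonneg (t := t) hp.le hpone u (𝒜 \ family n u s)
    have ny' := scaledMu_nonneg (t := t) hp.le hpone v (ℬ \ family n v s')
    have fx : scaledMu p t u (𝒜 ∩ family n u s) ≤ coeff p (t + s + s') s * Y := by
      have := scaledMu_family_le (n := n) (t := t) hp hpone u s
      rw [show u + 2 * s = t + s + s' by omega] at this
      exact (scaledMu_mono hp.le hpone u inter_subset_right).trans this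
    have fy : scaledMu p t v (ℬ ∩ family n v s') ≤ coeff p (t + s + s') s' * Y := by
      have := scaledMu_family_le (n := n) (t := t) hp hpone v s'
      rw [show v + 2 * s' = t + s + s' by omega] at this
      exact (scaledMu_mono hp.le hpone v inter_subset_right).trans this
    have gx : scaledMu p t u (𝒜 ∩ family n u s) ≤ C * Y := by linarith
    have gy : scaledMu p t v (ℬ ∩ family n v s') ≤ C * Y := by linarith
    -- Each scaled measure splits into a part inside the extremal family and an excess of order `p`;
    -- the three products involving an excess add up to at most `8 C² p Y²`.
    have hmain : scaledMu p t u 𝒜 * scaledMu p t v ℬ ≤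
        (prodCoeff p t s s' + 8 * C ^ 2 * p) * Y ^ 2 := by
      rw [← ex, ← ey]
      have e1 : scaledMu p t u (𝒜 ∩ family n u s) * scaledMu p t v (ℬ ∩ family n v s') ≤
          prodCoeff p t s s' * Y ^ 2 := by
        refine (mul_le_mul fx fy ny (nx.trans fx)).trans (le_of_eq ?_)
        unfold prodCoeff
        ring
      have e2 := mul_le_mul gx hye ny' (by positivity)
      have e3 := mul_le_mul hxe gy ny (by positivity)
      have e4 := mul_le_mul hxe hye ny' (by positivity)
      have e5 : p * (C ^ 2 * p * Y ^ 2) ≤ 1 * (C ^ 2 * p * Y ^ 2) :=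
        mul_le_mul_of_nonneg_right hpone (by positivity)
      rw [add_mul, mul_add, mul_add]
      linarith
    rw [hxy] at hmain
    have h1 : (1 - δ₁) * (B ^ 2 * (1 - 2 * r * p)) ≤ prodCoeff p t s s' + 8 * C ^ 2 * p := by
      refine le_of_mul_le_mul_right ?_ (show 0 < Y ^ 2 by positivity)
      linarith
    rw [hκ] at hG
    have h2 : (1 / ((r : ℝ) + 2) - δ₁) * g ^ 2 ≤ (1 / ((r : ℝ) + 2) - δ₁) * B ^ 2 := by
      gcongr
    have h3 : (1 - δ₁) * (B ^ 2 * (2 * r * p)) ≤ coeffBound r ^ 2 * (2 * r * p) := by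
      have e1 : B ^ 2 ≤ coeffBound r ^ 2 := pow_le_pow_left₀ hB0.le hBD 2
      have e2 : B ^ 2 * (2 * r * p) ≤ coeffBound r ^ 2 * (2 * r * p) :=
        mul_le_mul_of_nonneg_right e1 (by positivity)
      exact (mul_le_of_le_one_left (by positivity) (by linarith)).trans e2
    linarith
  refine ⟨u, v, s, s', hRex, huv, hss, hsn, ?_, ?_, ?_, ?_, hxe, hye⟩
  · rcases hRex with h | h <;> rw [mem_Rex] at h <;> omega
  · rcases hRex with h | h <;> rw [mem_Rex] at h <;> omega
  -- The product is at least `g²/8 * Y²` and each factor at most `C * Y`; this is the source of the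
  -- constant `g²/(8C)`.
  · have h1 : g ^ 2 / 8 * Y ^ 2 ≤ scaledMu p t u 𝒜 * (C * Y) :=
      (hμc.trans_eq hxy.symm).trans (mul_le_mul_of_nonneg_left hy hx0)
    refine le_of_mul_le_mul_right ?_ (show 0 < C * Y by positivity)
    refine le_trans (le_of_eq ?_) h1
    rw [← hYdef]
    field_simp
  · have h1 : g ^ 2 / 8 * Y ^ 2 ≤ C * Y * scaledMu p t v ℬ :=
      (hμc.trans_eq hxy.symm).trans (mul_le_mul_of_nonneg_right hx hy0)
    refine le_of_mul_le_mul_left ?_ (show 0 < C * Y by positivity)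
    refine le_trans (le_of_eq ?_) h1
    rw [← hYdef]
    field_simp

/-- The excess decays like `(2p) ^ (K - 1)`, the excluded part only like `2 ^ (-K)`, so small `p`
makes the ratio small for all `K ≥ 2` at once. -/
theorem eventually_excess_le (r : ℕ) {γ c η : ℝ} (hγ : 0 < γ) (hγ' : γ ≤ 1) (hc : 0 < c)
    (hη : 0 < η) :
    ∀ᶠ p in 𝓝[>] (0 : ℝ), ∀ {t n u v s s' : ℕ} {𝒜 ℬ : Finset (Finset (Fin n))}, Regime r γ p t →
      IsNice t 𝒜 ℬ → Aligned r p c t u v s s' 𝒜 ℬ →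
      scaledMu p t u (𝒜 \ family n u s) ≤ η * scaledMu p t v (family n v s' \ ℬ) := by
  have hg := coeffLower_pos r hγ
  have hC := oddsBound_pos r
  have hr : (0 : ℝ) ≤ r := Nat.cast_nonneg r
  filter_upwards [eventually_mul_lt (r + 1) (half_pos hγ), eventually_mul_lt 4 one_pos,
    eventually_mul_lt ((2 * r + 2) * coeffBound r + coeffBound r * (r + 4) + 2 * oddsBound r) hc,
    eventually_mul_lt (2 * oddsBound r)
      (show 0 < η * (coeffLower r γ * (1 / 2) ^ (r + 4)) by positivity)]
    with p hp1 hp2 hp3 hp4 t n u v s s' 𝒜 ℬ h hnice hal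
  have hp := h.pos
  have hpone : p ≤ 1 := by linarith [h.le_half]
  have hY : 0 < p ^ t := pow_pos hp t
  have hs' := hal.right_le
  have huv := hal.add_eq
  have hss := hal.support_eq
  have ht := h.le_t
  have hα0 := h.odds_pos
  have hα := h.odds_le
  rcases eq_empty_or_nonempty (𝒜 \ family n u s) with he | hne
  · rw [he, scaledMu, mu, sum_empty, mul_zero]
    exact mul_nonneg hη.le (scaledMu_nonneg hp.le hpone _ _)
  obtain ⟨K, hK1, hK2⟩ := hnice.exists_excluded hp h.le_half huv hss hal.support_le (by omega) hne
  have hZ : coeff p t s' * ((1 - p) ^ (s' + K) * (1 - p / (1 - p))) * p ^ t ≤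
      scaledMu p t v (family n v s' \ ℬ) := by
    have h1 := le_scaledMu_of_le_mu (t := t) (u := v) (j := s')
      (c := t.choose s' * ((1 - p) ^ (s' + K) * (1 - p / (1 - p)))) hp
      (le_trans (le_of_eq (by ring)) hK2)
    refine le_trans (le_of_eq ?_) h1
    unfold coeff
    ring
  have hb := h.coeff_le_coeffBound (m := t) (k := s') (by omega) hs'
  have hb0 := coeff_nonneg hp.le t s'
  -- For `K ≤ 1` the excluded part is all of `family n v s'` up to order `p`, which would leave `ℬ`
  -- with less than `c * p ^ t`.
  rcases Nat.lt_or_ge K 2 with hK | hK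
  · exfalso
    have h1 : 1 - (r + 2) * p ≤ (1 - p) ^ (s' + K) := by
      have e1 := one_add_mul_le_pow (a := -p) (by linarith) (r + 2)
      have e2 : (1 - p) ^ (r + 2) ≤ (1 - p) ^ (s' + K) :=
        pow_le_pow_of_le_one (by linarith) (by linarith) (by omega)
      rw [← sub_eq_add_neg] at e1
      push_cast at e1
      linarith
    have h2 : 1 - (r + 4) * p ≤ (1 - p) ^ (s' + K) * (1 - p / (1 - p)) := by
      have e1 : (1 - p) ^ (s' + K) ≤ 1 := pow_le_one₀ (by linarith) (by linarith)
      have e2 : (1 - p) ^ (s' + K) * (p / (1 - p)) ≤ 1 * (2 * p) :=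
        mul_le_mul e1 hα hα0.le zero_le_one
      linarith
    have h3 : (coeff p t s' - coeffBound r * ((r + 4) * p)) * p ^ t ≤
        scaledMu p t v (family n v s' \ ℬ) := by
      refine le_trans (mul_le_mul_of_nonneg_right ?_ hY.le) hZ
      have e1 := mul_le_mul_of_nonneg_left h2 hb0
      have e2 : coeff p t s' * ((r + 4) * p) ≤ coeffBound r * ((r + 4) * p) :=
        mul_le_mul_of_nonneg_right hb (by positivity)
      linarith
    have h4 := scaledMu_family_le (n := n) (t := t) hp hpone v s'
    have h5 := h.coeff_le_coeff_add (m := v + 2 * s') (k := s')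
      (by have := hal.left_le; omega) hs'
    have h6 : scaledMu p t v (family n v s') ≤
        (coeff p t s' + (2 * r + 2) * coeffBound r * p) * p ^ t :=
      h4.trans (mul_le_mul_of_nonneg_right h5 hY.le)
    have h7 := scaledMu_inter_add_sdiff (p := p) (t := t) v (family n v s') ℬ
    have h8 := scaledMu_inter_add_sdiff (p := p) (t := t) v ℬ (family n v s')
    rw [inter_comm] at h8
    have h9 := hal.le_right
    have h10 := hal.excess_right
    have h11 := mul_lt_mul_of_pos_right hp3 hY
    linarith
  · obtain ⟨k, rfl⟩ : ∃ k, K = k + 2 := ⟨K - 2, by omega⟩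
    have h1 : scaledMu p t u (𝒜 \ family n u s) ≤ oddsBound r * (2 * p) ^ (k + 1) * p ^ t := by
      have := scaledMu_le_of_mu_le (t := t) (u := u) (j := 0)
        (c := oddsBound r * (2 * p) ^ (k + 1)) (𝒜 := 𝒜 \ family n u s) hp (by
          refine (hK1 (by omega)).trans ?_
          rw [show u + (k + 2 - 1) = u + (k + 1) by omega, pow_add, add_zero]
          refine (mul_le_mul (h.odds_pow_le (by omega)) (pow_le_pow_left₀ hα0.le hα _)
            (by positivity) (by positivity)).trans (le_of_eq (by ring)))
      simpa using this
    have h2 : (2 * p) ^ k ≤ (1 / 2 : ℝ) ^ k := pow_le_pow_left₀ (by positivity) (by linarith) k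
    have h3 : coeffLower r γ * ((1 / 2) ^ (r + 3) * (1 / 2) ^ k * (1 / 2)) ≤
        coeff p t s' * ((1 - p) ^ (s' + (k + 2)) * (1 - p / (1 - p))) := by
      have e1 : coeffLower r γ ≤ coeff p t s' := h.le_coeff hγ hγ' hp1.le hs'
      have e2 : (1 / 2 : ℝ) ^ (r + 3) * (1 / 2) ^ k ≤ (1 - p) ^ (s' + (k + 2)) := by
        rw [← pow_add]
        refine (pow_le_pow_of_le_one (by norm_num) (by norm_num)
          (show s' + (k + 2) ≤ r + 3 + k by omega)).trans ?_
        exact pow_le_pow_left₀ (by norm_num) (by linarith [h.le_half]) _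
      have e3 : (1 : ℝ) / 2 ≤ 1 - p / (1 - p) := by linarith
      have e4 : 0 ≤ (1 - p) ^ (s' + (k + 2)) := pow_nonneg (by linarith) _
      exact mul_le_mul e1 (mul_le_mul e2 e3 (by norm_num) e4) (by positivity) hb0
    calc scaledMu p t u (𝒜 \ family n u s) ≤ oddsBound r * (2 * p) ^ (k + 1) * p ^ t := h1
      _ = 2 * oddsBound r * p * (2 * p) ^ k * p ^ t := by ring
      _ ≤ η * (coeffLower r γ * (1 / 2) ^ (r + 4)) * (1 / 2) ^ k * p ^ t := by
          gcongr
      _ = η * (coeffLower r γ * ((1 / 2) ^ (r + 3) * (1 / 2) ^ k * (1 / 2)) * p ^ t) := by ring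
      _ ≤ η * scaledMu p t v (family n v s' \ ℬ) :=
          mul_le_mul_of_nonneg_left ((mul_le_mul_of_nonneg_right h3 hY.le).trans hZ) hη.le

theorem eventually_conclusions (r : ℕ) {γ c ε₁ : ℝ} (hγ : 0 < γ) (hγ' : γ ≤ 1) (hc : 0 < c)
    (hε₁ : 0 < ε₁) (hε₁' : ε₁ < 1 / 2) :
    ∀ᶠ p in 𝓝[>] (0 : ℝ), ∀ {t n u v s s' : ℕ} {𝒜 ℬ : Finset (Finset (Fin n))}, Regime r γ p t →
      IsNice t 𝒜 ℬ → Aligned r p c t u v s s' 𝒜 ℬ → Conclusions p ε₁ t u v s s' 𝒜 ℬ := by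
  have hg := coeffLower_pos r hγ
  have hD : 0 < coeffBound r := zero_lt_one.trans_le (one_le_coeffBound r)
  set L : ℝ := coeffLower r γ * (1 / 2) ^ (r + 1) with hL
  have hL0 : 0 < L := by positivity
  -- The bound `ε₁` serves the symmetric-difference estimate. The other two serve the product: as
  -- `L` and `coeffBound r` bound both scaled extremal measures, `η` times either one is at most a
  -- quarter of the other.
  set η : ℝ := min ε₁ (min (1 / 4) (L / (4 * coeffBound r))) with hηdef
  have hη : 0 < η := lt_min hε₁ (lt_min (by norm_num) (by positivity))
  have hη3 : η ≤ L / (4 * coeffBound r) := (min_le_right _ _).trans (min_le_right _ _)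
  have hη2 : η ≤ 1 / 4 := (min_le_right _ _).trans (min_le_left _ _)
  filter_upwards [eventually_mul_lt (r + 1) (half_pos hγ),
    eventually_excess_le r hγ hγ' hc hη] with p hp1 hex t n u v s s' 𝒜 ℬ h hnice hal
  have hp := h.pos
  have hpone : p ≤ 1 := by linarith [h.le_half]
  have hY : 0 < p ^ t := pow_pos hp t
  have hlow : ∀ {u v s s' : ℕ} {𝒜 ℬ : Finset (Finset (Fin n))}, Aligned r p c t u v s s' 𝒜 ℬ →
      L * p ^ t ≤ scaledMu p t u (family n u s) := by
    intro u v s s' 𝒜 ℬ hal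
    have huv := hal.add_eq
    have hss := hal.support_eq
    refine le_trans ?_ (le_scaledMu_family hp hpone hal.support_le)
    have e1 : coeffLower r γ ≤ coeff p (u + 2 * s) s :=
      (h.le_coeff hγ hγ' hp1.le hal.left_le).trans (coeff_mono hp.le (by omega) s)
    have e2 : (1 / 2 : ℝ) ^ (r + 1) ≤ (1 - p) ^ s :=
      (pow_le_pow_of_le_one (by norm_num) (by norm_num) hal.left_le).trans
        (pow_le_pow_left₀ (by norm_num) (by linarith [h.le_half]) _)
    exact mul_le_mul_of_nonneg_right
      (mul_le_mul e1 e2 (by positivity) (coeff_nonneg hp.le _ _)) hY.le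
  have hupp : ∀ {u v s s' : ℕ} {𝒜 ℬ : Finset (Finset (Fin n))}, Aligned r p c t u v s s' 𝒜 ℬ →
      η * scaledMu p t u (family n u s) ≤ L * p ^ t / 4 := by
    intro u v s s' 𝒜 ℬ hal
    have huv := hal.add_eq
    have hss := hal.support_eq
    have hs := hal.left_le
    have hs' := hal.right_le
    have e1 : scaledMu p t u (family n u s) ≤ coeffBound r * p ^ t :=
      (scaledMu_family_le hp hpone u s).trans
        (mul_le_mul_of_nonneg_right (h.coeff_le_coeffBound (by omega) hs) hY.le)
    refine (mul_le_mul hη3 e1 (scaledMu_nonneg hp.le hpone _ _) (by positivity)).trans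
      (le_of_eq ?_)
    field_simp
  have hlA := hlow hal
  have hlB := hlow hal.symm
  have huA := hupp hal
  have huB := hupp hal.symm
  have hLY : 0 < L * p ^ t := by positivity
  exact conclusions_of_small_excess hp (by linarith [h.le_half]) hal.add_eq hη (min_le_left _ _)
    hε₁' hη2 (hex h hnice hal) (hex h hnice.symm hal.symm) (by linarith) (by linarith)
    (by linarith) (by linarith)

/-! ### Uniqueness of the pair -/

theorem scaledMu_le_mul_of_lt {p : ℝ} {n t u u₁ : ℕ} (hp : 0 < p) (hp' : p ≤ 1) (hu : u < u₁)
    (𝒜 : Finset (Finset (Fin n))) : scaledMu p t u 𝒜 ≤ p * scaledMu p t u₁ 𝒜 := by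
  unfold scaledMu
  rw [← mul_assoc]
  refine mul_le_mul_of_nonneg_right ?_ (mu_nonneg hp.le hp' _)
  rw [← zpow_one_add₀ hp.ne']
  exact zpow_le_zpow_right_of_le_one₀ hp hp' (by omega)

/-- The extremal families for which the estimate `(b)` holds are determined by the nice pair. -/
theorem eventually_unique (r : ℕ) {γ c ε₁ δ₁ : ℝ} (hγ : 0 < γ) (hγ' : γ ≤ 1) (hc : 0 < c)
    (hε₁ : 0 < ε₁) (hε₁' : ε₁ < 1 / 2) (hδ₁ : 0 < δ₁) (hδ₁' : δ₁ < 1)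
    (hthr : ε₁ < √(1 - δ₁) / (1 + √(1 - δ₁))) :
    ∀ᶠ p in 𝓝[>] (0 : ℝ), ∀ {t n u v s s' u₁ v₁ w w' : ℕ} {𝒜 ℬ : Finset (Finset (Fin n))},
      Regime r γ p t → t + 2 * r ≤ n →
      (1 - δ₁) * mu p (family n t r) ^ 2 ≤ mu p 𝒜 * mu p ℬ →
      Aligned r p c t u v s s' 𝒜 ℬ →
      u₁ + v₁ = 2 * t → u₁ + 2 * w = v₁ + 2 * w' → w ≤ r + 1 → w' ≤ r + 1 →
      Conclusions p ε₁ t u₁ v₁ w w' 𝒜 ℬ → u₁ = u ∧ w = s := by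
  have hg := coeffLower_pos r hγ
  have hC := oddsBound_pos r
  have hD : 0 < coeffBound r := zero_lt_one.trans_le (one_le_coeffBound r)
  have hr : (0 : ℝ) ≤ r := Nat.cast_nonneg r
  set ρ := √(1 - δ₁) with hρ
  have hρ0 : 0 < ρ := Real.sqrt_pos.2 (by linarith)
  have hρ1 : ρ ≤ 1 := Real.sqrt_le_one.2 (by linarith)
  have hρ2 : ρ ^ 2 = 1 - δ₁ := Real.sq_sqrt (by linarith)
  -- The threshold for `ε₁`, rearranged into the gap that must absorb all errors of order `p`.
  have hθ : 0 < (1 - ε₁) * ρ - ε₁ := by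
    rw [lt_div_iff₀ (by linarith)] at hthr
    linarith
  set E : ℝ := (5 * r + 2) * coeffBound r with hE
  have hE0 : 0 ≤ E := by positivity
  filter_upwards [eventually_mul_lt (r + 1) (half_pos hγ),
    eventually_mul_lt (3 * coeffBound r) hc,
    eventually_mul_lt (2 * r * coeffBound r + 8 * oddsBound r + 2 * E)
      (show 0 < 2 * (coeffLower r γ * ((1 - ε₁) * ρ - ε₁)) by positivity)]
    with p hp1 hp2 hp3 t n u v s s' u₁ v₁ w w' 𝒜 ℬ h hn hμ hal huv₁ hw hwr hwr' hconc
  have hp := h.pos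
  have hpone : p ≤ 1 := by linarith [h.le_half]
  have hY : 0 < p ^ t := pow_pos hp t
  have huv := hal.add_eq
  have hss := hal.support_eq
  have hstar := hconc.star_le
  rw [normSum_eq, normSum_eq, scaledMu_symmDiff, scaledMu_symmDiff] at hstar
  have hG : ∀ a b, a ≤ r + 1 → b = t + w + w' → coeff p b a ≤ coeff p t r + E * p := by
    intro a b ha hb
    have e1 := h.coeff_le_coeff_add (m := b) (by omega) ha
    have e2 := h.coeff_le_coeff_r ha
    rw [hE]
    linarith
  have hG1 := scaledMu_family_le (n := n) (t := t) hp hpone u₁ w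
  have hG2 := scaledMu_family_le (n := n) (t := t) hp hpone v₁ w'
  have hG1' := hG1.trans (mul_le_mul_of_nonneg_right (hG w _ hwr (by omega)) hY.le)
  have hG2' := hG2.trans (mul_le_mul_of_nonneg_right (hG w' _ hwr' (by omega)) hY.le)
  have hG1'' := hG1.trans
    (mul_le_mul_of_nonneg_right (h.coeff_le_coeffBound (by omega) hwr) hY.le)
  have hG2'' := hG2.trans
    (mul_le_mul_of_nonneg_right (h.coeff_le_coeffBound (by omega) hwr') hY.le)
  have d1 := scaledMu_mono (t := t) hp.le hpone u₁ (sdiff_subset (s := family n u₁ w) (t := 𝒜))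
  have d2 := scaledMu_mono (t := t) hp.le hpone v₁ (sdiff_subset (s := family n v₁ w') (t := ℬ))
  have n1 := scaledMu_nonneg (t := t) hp.le hpone u₁ (𝒜 \ family n u₁ w)
  have n2 := scaledMu_nonneg (t := t) hp.le hpone v₁ (ℬ \ family n v₁ w')
  have i1 := scaledMu_inter_add_sdiff (p := p) (t := t) u₁ 𝒜 (family n u₁ w)
  have i2 := scaledMu_inter_add_sdiff (p := p) (t := t) v₁ ℬ (family n v₁ w')
  have m1 := scaledMu_mono (t := t) hp.le hpone u₁
    (inter_subset_right (s₁ := 𝒜) (s₂ := family n u₁ w))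
  have m2 := scaledMu_mono (t := t) hp.le hpone v₁
    (inter_subset_right (s₁ := ℬ) (s₂ := family n v₁ w'))
  -- In the symmetric difference the deficits are bounded by the full extremal families, and the
  -- excesses are moved to the left.
  have hS : (1 - ε₁) * (scaledMu p t u₁ (𝒜 \ family n u₁ w) +
      scaledMu p t v₁ (ℬ \ family n v₁ w')) ≤
      ε₁ * (scaledMu p t u₁ (family n u₁ w) + scaledMu p t v₁ (family n v₁ w')) := by
    have := mul_le_mul_of_nonneg_left (add_le_add d1 d2) hε₁.le
    linarith
  have hS2 : scaledMu p t u₁ (𝒜 \ family n u₁ w) + scaledMu p t v₁ (ℬ \ family n v₁ w') ≤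
      2 * coeffBound r * p ^ t := by
    have e1 : ε₁ * (scaledMu p t u₁ (family n u₁ w) + scaledMu p t v₁ (family n v₁ w')) ≤
        1 / 2 * (2 * coeffBound r * p ^ t) := by
      refine mul_le_mul hε₁'.le (by linarith) ?_ (by norm_num)
      exact add_nonneg (scaledMu_nonneg hp.le hpone _ _) (scaledMu_nonneg hp.le hpone _ _)
    have e2 : 1 / 2 * (scaledMu p t u₁ (𝒜 \ family n u₁ w) +
        scaledMu p t v₁ (ℬ \ family n v₁ w')) ≤ (1 - ε₁) *
        (scaledMu p t u₁ (𝒜 \ family n u₁ w) + scaledMu p t v₁ (ℬ \ family n v₁ w')) :=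
      mul_le_mul_of_nonneg_right (by linarith) (add_nonneg n1 n2)
    linarith
  have hp2Y := mul_lt_mul_of_pos_right hp2 hY
  -- If the exponents differ, one of the two families has scaled measure at most `3 * coeffBound r *
  -- p ^ t` for the new exponent, hence a further factor `p` for the old one, below the lower bound
  -- `c * p ^ t`.
  have huu : u₁ = u := by
    rcases lt_trichotomy u u₁ with hlt | heq | hgt
    · exfalso
      have e1 := scaledMu_le_mul_of_lt (t := t) hp hpone hlt 𝒜
      have e2 := hal.le_left
      have e3 : p * scaledMu p t u₁ 𝒜 ≤ p * (3 * coeffBound r * p ^ t) :=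
        mul_le_mul_of_nonneg_left (by linarith) hp.le
      linarith
    · exact heq.symm
    · exfalso
      have e1 := scaledMu_le_mul_of_lt (t := t) hp hpone (show v < v₁ by omega) ℬ
      have e2 := hal.le_right
      have e3 : p * scaledMu p t v₁ ℬ ≤ p * (3 * coeffBound r * p ^ t) :=
        mul_le_mul_of_nonneg_left (by linarith) hp.le
      linarith
  refine ⟨huu, ?_⟩
  by_contra hws
  subst huu
  obtain rfl : v₁ = v := by omega
  -- A family nearly contained in one extremal family almost misses another with the same
  -- superscript, as the two extremal families have small intersection.
  have hsub : ∀ (a b b' : ℕ) (𝒳 : Finset (Finset (Fin n))), a ≤ 2 * t → b ≠ b' →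
      scaledMu p t a (𝒳 \ family n a b) ≤ 2 * oddsBound r * p * p ^ t →
      scaledMu p t a (𝒳 ∩ family n a b') ≤ 4 * oddsBound r * p * p ^ t := by
    intro a b b' 𝒳 ha hb hX
    have e1 : 𝒳 ∩ family n a b' ⊆ (𝒳 \ family n a b) ∪ (family n a b ∩ family n a b') := by
      intro x hx
      simp only [Finset.mem_inter, Finset.mem_union, Finset.mem_sdiff] at hx ⊢
      by_cases hxb : x ∈ family n a b
      · exact Or.inr ⟨hxb, hx.2⟩
      · exact Or.inl ⟨hx.1, hxb⟩
    have e2 := (scaledMu_mono (t := t) hp.le hpone a e1).trans (scaledMu_union_le hp.le hpone a _ _)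
    have e3 := scaledMu_le_of_mu_le (t := t) (u := a) (j := 1) (c := 2 * oddsBound r) hp
      ((mu_family_inter_family_le hp h.le_half n a hb).trans
        (by rw [mul_assoc]; gcongr; exact h.odds_pow_le (by omega)))
    rw [pow_one] at e3
    linarith
  have s1 := hsub u₁ s w 𝒜 (by omega) (Ne.symm hws) hal.excess_left
  have s2 := hsub v₁ s' w' ℬ (by omega) (by omega) hal.excess_right
  have hxy := scaledMu_mul_scaledMu hp.ne' huv 𝒜 ℬ
  have hx0 := scaledMu_nonneg (t := t) hp.le hpone u₁ 𝒜
  have hy0 := scaledMu_nonneg (t := t) hp.le hpone v₁ ℬ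
  have hF0 := mu_nonneg hp.le hpone (family n t r)
  -- The arithmetic-geometric mean inequality turns the hypothesis on the product into one on the
  -- sum.
  have hsum : 2 * (ρ * mu p (family n t r)) ≤ scaledMu p t u₁ 𝒜 + scaledMu p t v₁ ℬ := by
    refine (pow_le_pow_iff_left₀ (by positivity) (by positivity) two_ne_zero).1 ?_
    calc (2 * (ρ * mu p (family n t r))) ^ 2
        = 4 * ((1 - δ₁) * mu p (family n t r) ^ 2) := by
          rw [← hρ2]
          ring
      _ ≤ 4 * (scaledMu p t u₁ 𝒜 * scaledMu p t v₁ ℬ) := by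
          rw [hxy]
          exact mul_le_mul_of_nonneg_left hμ (by norm_num)
      _ = 4 * scaledMu p t u₁ 𝒜 * scaledMu p t v₁ ℬ := by ring
      _ ≤ _ := four_mul_le_sq_add _ _
  have hF := mul_le_mul_of_nonneg_left (h.le_mu_family hn) hρ0.le
  set B := coeff p t r with hB
  have hgB : coeffLower r γ ≤ B := h.le_coeff hγ hγ' hp1.le (by omega)
  have hBD : B ≤ coeffBound r := h.coeff_le_coeffBound (by omega) (by omega)
  have hB0 : 0 < B := hg.trans_le hgB
  -- Nearly the whole sum of the scaled measures is excess. To leading order this reads `(1 - ε₁) ρ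
  -- B ≤ ε₁ B`, contrary to the threshold.
  have hfin : (1 - ε₁) * (2 * (ρ * (B * (1 - r * p))) - 8 * oddsBound r * p) ≤
      ε₁ * (2 * B + 2 * E * p) := by
    refine le_of_mul_le_mul_right ?_ hY
    have e1 : (2 * (ρ * (B * (1 - r * p))) - 8 * oddsBound r * p) * p ^ t ≤
        scaledMu p t u₁ (𝒜 \ family n u₁ w) + scaledMu p t v₁ (ℬ \ family n v₁ w') := by
      linarith
    have e2 := mul_le_mul_of_nonneg_left e1 (show 0 ≤ 1 - ε₁ by linarith)
    have e3 : ε₁ * (scaledMu p t u₁ (family n u₁ w) + scaledMu p t v₁ (family n v₁ w')) ≤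
        ε₁ * ((2 * B + 2 * E * p) * p ^ t) := mul_le_mul_of_nonneg_left (by linarith) hε₁.le
    linarith
  have f1 : coeffLower r γ * ((1 - ε₁) * ρ - ε₁) ≤ B * ((1 - ε₁) * ρ - ε₁) :=
    mul_le_mul_of_nonneg_right hgB hθ.le
  have f2 : (1 - ε₁) * ρ * (B * (r * p)) ≤ 1 * (coeffBound r * (r * p)) := by
    refine mul_le_mul ?_ (mul_le_mul_of_nonneg_right hBD (by positivity)) (by positivity) zero_le_one
    exact mul_le_one₀ (by linarith) hρ0.le hρ1
  have f3 : (1 - ε₁) * (8 * oddsBound r * p) ≤ 1 * (8 * oddsBound r * p) :=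
    mul_le_mul_of_nonneg_right (by linarith) (by positivity)
  have f4 : ε₁ * (2 * E * p) ≤ 1 * (2 * E * p) :=
    mul_le_mul_of_nonneg_right (by linarith) (by positivity)
  linarith

/-! ### Assembly and the threshold for `t` -/

theorem HoldsUpToSwitch.symm {n : ℕ} {p ε₁ : ℝ} {t : ℕ} {σ : ℕ × ℕ}
    {𝒜 ℬ : Finset (Finset (Fin n))} (h : HoldsUpToSwitch p ε₁ t σ 𝒜 ℬ) :
    HoldsUpToSwitch p ε₁ t σ ℬ 𝒜 := Or.symm h

theorem eventually_stability (r : ℕ) {γ ε₁ δ₁ : ℝ} (hγ : 0 < γ) (hγ' : γ ≤ 1)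
    (hε₁ : 0 < ε₁) (hε₁' : ε₁ < 1 / 2) (hδ₁ : 0 < δ₁) (hδ₁' : δ₁ < 1 / ((r : ℝ) + 2)) :
    ∀ᶠ p in 𝓝[>] (0 : ℝ), ∀ {t n : ℕ}, Regime r γ p t → t + 2 * r ≤ n →
      Stability r ε₁ δ₁ n t p := by
  have hc : 0 < coeffLower r γ ^ 2 / (8 * oddsBound r) := by
    have := coeffLower_pos r hγ
    have := oddsBound_pos r
    positivity
  have hδ1 : δ₁ < 1 := by
    have hr : (0 : ℝ) ≤ r := Nat.cast_nonneg r
    refine hδ₁'.trans_le ?_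
    rw [div_le_one (by positivity)]
    linarith
  have huniq : ε₁ < √(1 - δ₁) / (1 + √(1 - δ₁)) → _ :=
    eventually_unique r hγ hγ' hc hε₁ hε₁' hδ₁ hδ1
  rw [← eventually_imp_distrib_left] at huniq
  filter_upwards [eventually_exists_aligned r hγ hγ' hδ₁ hδ₁',
    eventually_conclusions r hγ hγ' hc hε₁ hε₁', huniq] with p hex hconc huniq t n h hn
  have key : ∀ {u v s s' : ℕ} {𝒜 ℬ : Finset (Finset (Fin n))}, IsNice t 𝒜 ℬ →
      (1 - δ₁) * mu p (family n t r) ^ 2 ≤ mu p 𝒜 * mu p ℬ →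
      Aligned r p (coeffLower r γ ^ 2 / (8 * oddsBound r)) t u v s s' 𝒜 ℬ → (s, s') ∈ Rex r →
      HoldsUpToSwitch p ε₁ t (s, s') 𝒜 ℬ ∧ (ε₁ < √(1 - δ₁) / (1 + √(1 - δ₁)) →
        ∀ τ ∈ Rex r, HoldsUpToSwitch p ε₁ t τ 𝒜 ℬ → τ = (s, s')) := by
    intro u v s s' 𝒜 ℬ hnice hμ hal hR
    have ht := h.le_t
    have huv := hal.add_eq
    have hss := hal.support_eq
    rw [mem_Rex] at hR
    refine ⟨Or.inl ?_, ?_⟩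
    · have := hconc h hnice hal
      rwa [show u = t - (s - s') by omega, show v = t + (s - s') by omega] at this
    · rintro hthr ⟨w, w'⟩ hτ hholds
      rw [mem_Rex] at hτ
      simp only [HoldsUpToSwitch] at hholds
      rcases hholds with h1 | h1
      · obtain ⟨e1, e2⟩ := huniq hthr h hn hμ hal (by omega) (by omega) (by omega) (by omega) h1
        rw [Prod.mk.injEq]
        omega
      · obtain ⟨e1, e2⟩ := huniq hthr h hn (by rwa [mul_comm (mu p ℬ)]) hal.symm (by omega)
          (by omega) (by omega) (by omega) h1
        rw [Prod.mk.injEq]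
        omega
  intro 𝒜 ℬ hnice hμ
  obtain ⟨u, v, s, s', hR | hR, hal⟩ := hex h hn hnice hμ
  · exact ⟨(s, s'), hR, key hnice hμ hal hR⟩
  · obtain ⟨k1, k2⟩ := key hnice.symm (by rwa [mul_comm (mu p ℬ)]) hal.symm hR
    exact ⟨(s', s), hR, k1.symm, fun hthr τ hτ hh => k2 hthr τ hτ hh.symm⟩

/-- As `p ≤ (r+1)/(t+2r+1)`, large `t` forces small `p`, so a statement valid for all small `p`
yields a threshold for `t`. -/
theorem exists_threshold (r : ℕ) {γ ε₁ δ₁ : ℝ} (hγ : 0 < γ) (hγ' : γ ≤ 1)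
    (hε₁ : 0 < ε₁) (hε₁' : ε₁ < 1 / 2) (hδ₁ : 0 < δ₁) (hδ₁' : δ₁ < 1 / ((r : ℝ) + 2)) :
    ∃ t₀ : ℕ, 2 * r + 2 ≤ t₀ ∧ ∀ n t : ℕ, t₀ ≤ t → t + 2 * r ≤ n → ∀ p : ℝ, 0 < p → γ ≤ t * p →
      (r : ℝ) ≤ p * (t + 2 * r - 1) → p ≤ ((r : ℝ) + 1) / ((t : ℝ) + 2 * r + 1) →
      Stability r ε₁ δ₁ n t p := by
  obtain ⟨p₀, hp₀, hsub⟩ := mem_nhdsGT_iff_exists_Ioo_subset.1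
    (eventually_stability r hγ hγ' hε₁ hε₁' hδ₁ hδ₁')
  rw [Set.mem_Ioi] at hp₀
  obtain ⟨N, hN⟩ := exists_nat_gt (((r : ℝ) + 1) / p₀)
  refine ⟨max (2 * r + 2) N, le_max_left _ _, fun n t ht hn p hp hγp hlow hupp => ?_⟩
  have ht1 : 2 * r + 2 ≤ t := (le_max_left _ _).trans ht
  have ht2 : (N : ℝ) ≤ t := by exact_mod_cast (le_max_right _ _).trans ht
  have ht1' : 2 * (r : ℝ) + 2 ≤ t := by exact_mod_cast ht1
  have hr : (0 : ℝ) ≤ r := Nat.cast_nonneg r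
  have hpos : (0 : ℝ) < t + 2 * r + 1 := by positivity
  refine hsub ⟨hp, hupp.trans_lt ?_⟩ ⟨hp, ?_, hγp, ?_, hlow, ht1⟩ hn
  · rw [div_lt_iff₀ hp₀] at hN
    rw [div_lt_iff₀ hpos]
    nlinarith
  · refine hupp.trans ?_
    rw [div_le_div_iff₀ hpos (by norm_num)]
    linarith
  · rwa [le_div_iff₀ hpos] at hupp

end CrossIntersecting

theorem theorem1p4 (r : ℕ) (ε₁ δ₁ : ℝ) (hε₁ : 0 < ε₁) (hε₁' : ε₁ < 1 / 2)
    (hδ₁ : 0 < δ₁) (hδ₁' : δ₁ < 1 / ((r : ℝ) + 2)) :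
    (1 ≤ r → ∃ t₀ : ℕ, 1 ≤ t₀ ∧ ∀ n t : ℕ, t₀ ≤ t → t + 2 * r ≤ n → ∀ p : ℝ,
      (r : ℝ) / ((t : ℝ) + 2 * r - 1) ≤ p → p ≤ ((r : ℝ) + 1) / ((t : ℝ) + 2 * r + 1) →
      CrossIntersecting.Stability r ε₁ δ₁ n t p) ∧
    (r = 0 → ∀ ε : ℝ, 0 < ε → ε < 1 / 2 →
      ∃ t₀ : ℕ, 1 ≤ t₀ ∧ ∀ n t : ℕ, t₀ ≤ t → t ≤ n → ∀ p : ℝ,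
      ε / (t : ℝ) ≤ p → p ≤ 1 / ((t : ℝ) + 1) →
      CrossIntersecting.Stability r ε₁ δ₁ n t p) := by
  constructor
  · intro hr
    -- For `r ≥ 1`, `tp ≥ tr/(t + 2r - 1) ≥ 1/2` once `t ≥ 2r + 2`, so `γ` can be absolute.
    obtain ⟨t₀, ht₀, H⟩ := CrossIntersecting.exists_threshold r (γ := 1 / 2) (by norm_num) (by norm_num) hε₁ hε₁'
      hδ₁ hδ₁'
    refine ⟨t₀, by omega, fun n t ht hn p hlow hupp => ?_⟩
    have hr' : (1 : ℝ) ≤ r := by exact_mod_cast hr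
    have ht' : 2 * (r : ℝ) + 2 ≤ t := by exact_mod_cast ht₀.trans ht
    have hpos : (0 : ℝ) < t + 2 * r - 1 := by linarith
    have hp : 0 < p := lt_of_lt_of_le (by positivity) hlow
    rw [div_le_iff₀ hpos] at hlow
    refine H n t ht hn p hp ?_ hlow hupp
    nlinarith
  · rintro rfl ε hε hε'
    -- For `r = 0` the only lower bound on `tp` is `ε`, hence the dependence of `t₀` on `ε`.
    obtain ⟨t₀, ht₀, H⟩ := CrossIntersecting.exists_threshold 0 hε (by linarith) hε₁ hε₁' hδ₁ hδ₁'
    refine ⟨t₀, by omega, fun n t ht hn p hlow hupp => ?_⟩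
    have ht' : (0 : ℝ) < t := by exact_mod_cast (by omega : 0 < t)
    have ht1 : (1 : ℝ) ≤ t := by exact_mod_cast (by omega : 1 ≤ t)
    have hp : 0 < p := lt_of_lt_of_le (by positivity) hlow
    refine H n t ht (by omega) p hp ?_ ?_ ?_
    · rw [div_le_iff₀ ht'] at hlow
      linarith
    · have : 0 ≤ p * (t - 1) := mul_nonneg hp.le (by linarith)
      simpa using this
    · simpa using hupp
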